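/- **Setting.** Let $\omega=(\omega_1,\omega_2)\in\mathbb{R}^2$ with $\omega_1,\omega_2>0$ be irrational, i.e. $\omega\cdot m\neq 0$ for every $m\in\mathbb{Z}^2\setminus\{0\}$. Let $\mathbb{T}^2_\omega$ be the flat torus with side lengths $\omega_1^{-1/2},\omega_2^{-1/2}$. In rescaled coordinates it is $(\mathbb{R}/\mathbb{Z})^2$ with normalized Haar measure and Laplacian $\Delta=\omega_1\partial_1^2+\omega_2\partial_2^2$. The character $x\mapsto e^{2\pi i k\cdot x}$, $k\in\mathbb{Z}^2$, is then an eigenfunction of $-\Delta$ with eigenvalue $4\pi^2\lambda_k$, where $\lambda_k=\omega_1k_1^2+\omega_2k_2^2$. Write $$\hat f_k=\int_{(\mathbb{R}/\mathbb{Z})^2} f(x)e^{-2\pi i k\cdot x}\,dx,\qquad \|f\|_s=\Big(\sum_{k\in\mathbb{Z}^2}(1+|k|^2)^s|\hat f_k|^2\Big)^{1/2},$$ let $H^s=\{f\in L^2:\|f\|_s<\infty\}$, and let $Q_M=\{k\in\mathbb{Z}^2:\|k\|_\infty\le M\}$. Consider the defocusing cubic Schrödinger equation $$i\partial_t\psi=\Delta\psi-|\psi|^2\psi,\qquad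 \psi(0)=\psi_0, \tag{NLS}$$ where the equation is understood in the sense of periodic distributions in $x$: for each $k$, the Fourier coefficient $\hat\psi_k(t)$ is differentiable in $t$ and satisfies $i\,\partial_t\hat\psi_k=-4\pi^2\lambda_k\hat\psi_k-(|\psi|^2\psi)^{\wedge}_k$. **Theorem.** Fix $s>1$, $\gamma<3$, $M>0$ and an irrational $\omega\in\mathbb{R}^2_+$. There is $\varepsilon_0=\varepsilon_0(s,M,\omega,\gamma)>0$ such that for every $\psi_0\in C^\infty(\mathbb{T}^2_\omega)$ with $\|\psi_0\|_s=\varepsilon$, $0<\varepsilon<\varepsilon_0$, and $\operatorname{supp}\hat\psi_0\subset Q_M$, the problem (NLS) has a unique solution $\psi\in C([0,1/\varepsilon^2];H^s)$, and this solution satisfies $$|\hat\psi_j(t)|<\varepsilon^\gamma\qquad\text{for all } t\in[0,1/\varepsilon^2]\text{ and all } j\in\mathbb{Z}^2\setminus Q_M .$$ -/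

import Mathlib

open MeasureTheory Filter Topology

noncomputable section

/-- The standard two-dimensional torus `(ℝ/ℤ)²`.
The flat torus with side lengths `ω₁^(-1/2)` and `ω₂^(-1/2)` is identified with it by rescaling
the coordinates; its Laplace-Beltrami operator then becomes `Δ_ω = ω₁ ∂₁² + ω₂ ∂₂²`. -/
abbrev Torus2 : Type := UnitAddTorus (Fin 2)

/-- The normalized Haar measure of the torus (the measure in `UnitAddTorus.mFourierCoeff`). -/
abbrev torusMeasure : Measure Torus2 := Measure.pi fun _ => AddCircle.haarAddCircle

/-- The space `L²` of the torus. -/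
abbrev L2Torus : Type := Lp ℂ 2 torusMeasure

/-- `ω` is irrational: `ω · m ≠ 0` for every nonzero integer vector `m`. -/
def IrrationalVector (ω : Fin 2 → ℝ) : Prop :=
  ∀ m : Fin 2 → ℤ, m ≠ 0 → ∑ i, ω i * (m i : ℝ) ≠ 0

/-- The eigenvalue of `-Δ_ω = -(ω₁ ∂₁² + ω₂ ∂₂²)` on the character `x ↦ exp (2πi k·x)`, that is
`4π² λ_k` with `λ_k = ω₁ k₁² + ω₂ k₂²`. -/
def laplaceEigenvalue (ω : Fin 2 → ℝ) (k : Fin 2 → ℤ) : ℝ :=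
  4 * Real.pi ^ 2 * ∑ i, ω i * (k i : ℝ) ^ 2

/-- The box `Q_M = {k ∈ ℤ² : ‖k‖_∞ ≤ M}`. -/
def boxQ (M : ℝ) : Set (Fin 2 → ℤ) :=
  {k | ∀ i, |(k i : ℝ)| ≤ M}

/-- The weight `⟨k⟩^(2s) = (1 + |k|²)^s`. -/
def sobolevWeight (s : ℝ) (k : Fin 2 → ℤ) : ℝ :=
  (1 + ∑ i, (k i : ℝ) ^ 2) ^ s

/-- An `L²` function belongs to `H^s`. -/
def MemSobolev (s : ℝ) (f : L2Torus) : Prop :=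
  Summable fun k : Fin 2 → ℤ => sobolevWeight s k * ‖UnitAddTorus.mFourierCoeff f k‖ ^ 2

/-- The norm `‖f‖_s = (∑_k ⟨k⟩^(2s) |f̂_k|²)^(1/2)` of `H^s`. -/
def sobolevNorm (s : ℝ) (f : Torus2 → ℂ) : ℝ :=
  Real.sqrt (∑' k : Fin 2 → ℤ, sobolevWeight s k * ‖UnitAddTorus.mFourierCoeff f k‖ ^ 2)

/-- `f` is a `C^∞` function on the torus: its periodic lift to `ℝ²` is smooth. -/
def SmoothOnTorus (f : Torus2 → ℂ) : Prop :=
  ContDiff ℝ (⊤ : ℕ∞) fun x : Fin 2 → ℝ => f fun i => (x i : UnitAddCircle)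

/-- `ψ ∈ C([0,T]; H^s)`. -/
def ContinuousInSobolev (s T : ℝ) (ψ : ℝ → L2Torus) : Prop :=
  (∀ t ∈ Set.Icc 0 T, MemSobolev s (ψ t)) ∧
    ∀ t₀ ∈ Set.Icc 0 T,
      Tendsto (fun t => sobolevNorm s (ψ t - ψ t₀ : L2Torus)) (𝓝[Set.Icc 0 T] t₀) (𝓝 0)

/-- `ψ ∈ C([0,T]; H^s)` solves the defocusing cubic Schrödinger equation
`i ∂_t ψ = Δ_ω ψ - |ψ|² ψ` with `ψ(0) = ψ₀`. The equation is understood in the sense of periodic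
distributions: each Fourier coefficient `t ↦ ψ̂_k(t)` is differentiable on `[0,T]` and satisfies
`i ∂_t ψ̂_k = -4π² λ_k ψ̂_k - (|ψ|²ψ)^_k`. It is used for `s > 1` only, where `H^s ⊂ C` and so
`|ψ|²ψ` is bounded. -/
structure IsNLSSolution (ω : Fin 2 → ℝ) (s T : ℝ) (ψ₀ : Torus2 → ℂ) (ψ : ℝ → L2Torus) :
    Prop where
  continuous : ContinuousInSobolev s T ψ
  initial : (ψ 0 : Torus2 → ℂ) =ᵐ[torusMeasure] ψ₀
  equation : ∀ k : Fin 2 → ℤ, ∀ t ∈ Set.Icc 0 T, ∃ d : ℂ,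
    HasDerivWithinAt (fun τ => UnitAddTorus.mFourierCoeff (ψ τ) k) d (Set.Icc 0 T) t ∧
      Complex.I * d = -(laplaceEigenvalue ω k : ℂ) * UnitAddTorus.mFourierCoeff (ψ t) k
        - UnitAddTorus.mFourierCoeff (fun x => ((‖ψ t x‖ ^ 2 : ℝ) : ℂ) * ψ t x) k


/-- The characters are eigenfunctions of `Δ_ω = ω₁ ∂₁² + ω₂ ∂₂²`. -/
theorem sum_deriv_mFourier (ω : Fin 2 → ℝ) (k : Fin 2 → ℤ) (x : Fin 2 → ℝ) :
    ∑ i, (ω i : ℂ) * deriv (deriv fun y : ℝ => UnitAddTorus.mFourier k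
        fun j => ((Function.update x i y j : ℝ) : UnitAddCircle)) (x i) =
      -(laplaceEigenvalue ω k : ℂ) *
        UnitAddTorus.mFourier k fun j => ((x j : ℝ) : UnitAddCircle) := by
  have key : ∀ i, deriv (deriv fun y : ℝ => UnitAddTorus.mFourier k
        fun j => ((Function.update x i y j : ℝ) : UnitAddCircle)) (x i) =
      (2 * Real.pi * Complex.I * k i) ^ 2 *
        UnitAddTorus.mFourier k fun j => ((x j : ℝ) : UnitAddCircle) := by
    intro i
    have h : ∀ y : ℝ, HasDerivAt (fun y : ℝ => UnitAddTorus.mFourier k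
        fun j => ((Function.update x i y j : ℝ) : UnitAddCircle))
        ((2 * Real.pi * Complex.I * k i) * UnitAddTorus.mFourier k
          fun j => ((Function.update x i y j : ℝ) : UnitAddCircle)) y := by
      intro y
      have h0 := hasDerivAt_fourier 1 (k i) y
      fin_cases i
      · simp [UnitAddTorus.mFourier, Fin.prod_univ_two] at h0 ⊢
        refine (h0.mul_const _).congr_deriv ?_
        ring
      · simp [UnitAddTorus.mFourier, Fin.prod_univ_two] at h0 ⊢
        refine (h0.const_mul _).congr_deriv ?_
        ring
    rw [funext fun y => (h y).deriv, ((h (x i)).const_mul _).deriv, Function.update_eq_self]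
    ring
  simp only [key, laplaceEigenvalue, Fin.sum_univ_two]
  push_cast
  linear_combination (4 * Real.pi ^ 2 * ((ω 0 : ℂ) * k 0 ^ 2 + ω 1 * k 1 ^ 2) *
    UnitAddTorus.mFourier k fun j => ((x j : ℝ) : UnitAddCircle)) * Complex.I_sq

end

/-! Put Λ_k = 4π²λ_k and pass to the unknowns a_k = w_k e^{-iΛ_k t} ψ̂_k, with w ≥ 1
submultiplicative. The linear flow disappears, and (NLS) becomes an ODE in ℓ¹ whose field `nlsField`
is a bounded cubic convolution with oscillating coefficients e^{i·phase·t}, phase = Λ_j - Λ_k + Λ_l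
- Λ_{j-k+l}.

Let Q be the set of lattice points of Q_M and split a into its part on Q and the rest q. Two facts
control them.

The part on Q is controlled by conservation of mass (`norm_fourierSeriesL2_eq`): |a_k| ≤ w_k ε for
each k, and Q is finite, so this part stays O(ε) in ℓ¹ as long as the solution exists.

The rest is fed only by interactions inside Q with output outside Q, and by interactions that
already contain a factor q. The former are never resonant (`phase_laplaceEigenvalue_ne_zero`): by
irrationality a vanishing phase means a rectangle with sides parallel to the axes, and three corners
in a box force the fourth into it. Since there are finitely many of them, their phases are bounded
away from 0 and no small divisor problem arises. Integration by parts in time (`normalForm`) trades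
this O(ε³) forcing for a boundary term O(ε³) and a forcing O(ε⁵). The interactions containing q
contribute O(ε²)‖q‖. Over a time 1/ε² Gronwall's inequality gives ‖q‖ ≤ Cε³
(`norm_removeFreq_solution_le`), provided that ‖a‖ = O(ε). A continuity argument from ‖q‖ ≤ ε
removes this proviso (`exists_long_time_solution`), and Cε³ < ε^γ for small ε.

Existence up to 1/ε² comes from a truncated field, which is globally bounded and still conserves
mass; the estimates show that the truncation is never active. For uniqueness, any H^s solution with
s > 1 has absolutely summable Fourier coefficients and solves the same ODE with weight 1, where the
field is locally Lipschitz. -/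

noncomputable section

open scoped ComplexConjugate

/-! ### Absolutely summable families -/

/-- The Banach space `ℓ¹(ι)` of absolutely summable complex families. -/
abbrev SummableSeq (ι : Type*) : Type _ := lp (fun _ : ι => ℂ) 1

namespace SummableSeq

variable {ι : Type*}

theorem summable_norm (a : SummableSeq ι) : Summable fun i => ‖a i‖ := by
  simpa using (lp.memℓp a).summable (by simp)

theorem norm_eq_tsum (a : SummableSeq ι) : ‖a‖ = ∑' i, ‖a i‖ := by
  simpa using lp.norm_eq_tsum_rpow (p := 1) (by simp) a

theorem norm_apply_le (a : SummableSeq ι) (i : ι) : ‖a i‖ ≤ ‖a‖ :=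
  lp.norm_apply_le_norm (by simp) a i

/-- The element of `ℓ¹` with given entries. -/
def mk (f : ι → ℂ) (hf : Summable fun i => ‖f i‖) : SummableSeq ι :=
  ⟨f, memℓp_gen (by simpa using hf)⟩

@[simp]
theorem mk_apply (f : ι → ℂ) (hf : Summable fun i => ‖f i‖) (i : ι) : mk f hf i = f i := rfl

variable {F : Type*} [NormedAddCommGroup F] [NormedSpace ℂ F]

theorem summable_norm_smul (a : SummableSeq ι) {x : ι → F} {C : ℝ} (hx : ∀ i, ‖x i‖ ≤ C) :
    Summable fun i => ‖a i • x i‖ := by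
  refine Summable.of_nonneg_of_le (fun _ => norm_nonneg _) (fun i => ?_)
    (a.summable_norm.mul_right C)
  rw [norm_smul]
  exact mul_le_mul_of_nonneg_left (hx i) (norm_nonneg _)

theorem norm_tsum_smul_le (a : SummableSeq ι) {x : ι → F} {C : ℝ} (hx : ∀ i, ‖x i‖ ≤ C) :
    ‖∑' i, a i • x i‖ ≤ C * ‖a‖ := by
  refine (norm_tsum_le_tsum_norm (f := fun i => a i • x i) (a.summable_norm_smul hx)).trans ?_
  have h : ∀ i, ‖a i • x i‖ ≤ C * ‖a i‖ := fun i => by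
    rw [norm_smul, mul_comm]
    exact mul_le_mul_of_nonneg_right (hx i) (norm_nonneg _)
  have h2 : ∑' i, ‖a i • x i‖ ≤ ∑' i, C * ‖a i‖ :=
    Summable.tsum_le_tsum h (a.summable_norm_smul hx) (a.summable_norm.mul_left C)
  rwa [tsum_mul_left, ← a.norm_eq_tsum] at h2

variable [CompleteSpace F]

/-- The linear map `a ↦ ∑ aᵢ xᵢ` attached to a bounded family `x`. -/
def liftLinear (x : ι → F) (C : ℝ) (hx : ∀ i, ‖x i‖ ≤ C) : SummableSeq ι →ₗ[ℂ] F where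
  toFun a := ∑' i, a i • x i
  map_add' a b := by
    have h := (a.summable_norm_smul hx).of_norm.tsum_add (b.summable_norm_smul hx).of_norm
    rw [← h]
    exact tsum_congr fun i => add_smul (a i) (b i) (x i)
  map_smul' c a := by
    have h := (a.summable_norm_smul hx).of_norm.tsum_const_smul c
    rw [RingHom.id_apply, ← h]
    exact tsum_congr fun i => mul_smul c (a i) (x i)

/-- The bounded linear map `a ↦ ∑ aᵢ xᵢ` attached to a bounded family `x`. -/
def lift (x : ι → F) (C : ℝ) (hx : ∀ i, ‖x i‖ ≤ C) : SummableSeq ι →L[ℂ] F :=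
  (liftLinear x C hx).mkContinuous C fun a => a.norm_tsum_smul_le hx

theorem lift_apply (x : ι → F) (C : ℝ) (hx : ∀ i, ‖x i‖ ≤ C) (a : SummableSeq ι) :
    lift x C hx a = ∑' i, a i • x i := rfl

theorem lift_hasSum (x : ι → F) (C : ℝ) (hx : ∀ i, ‖x i‖ ≤ C) (a : SummableSeq ι) :
    HasSum (fun i => a i • x i) (lift x C hx a) :=
  (a.summable_norm_smul hx).of_norm.hasSum

theorem lift_single [DecidableEq ι] (x : ι → F) (C : ℝ) (hx : ∀ i, ‖x i‖ ≤ C) (i : ι) (z : ℂ) :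
    lift x C hx (lp.single 1 i z) = z • x i := by
  rw [lift_apply, tsum_eq_single i]
  · rw [lp.single_apply_self]
  · intro j hj
    rw [lp.single_apply_ne _ _ _ hj, zero_smul]

theorem hasSum_norm_mul_mul (a b c : SummableSeq ι) :
    HasSum (fun x : ι × ι × ι => ‖a x.1‖ * (‖b x.2.1‖ * ‖c x.2.2‖)) (‖a‖ * (‖b‖ * ‖c‖)) := by
  have ha := a.summable_norm
  have hb := b.summable_norm
  have hc := c.summable_norm
  have hbc := hb.mul_of_nonneg hc (fun _ => norm_nonneg _) fun _ => norm_nonneg _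
  have habc := ha.mul_of_nonneg hbc (fun _ => norm_nonneg _) fun _ => by positivity
  rw [a.norm_eq_tsum, b.norm_eq_tsum, c.norm_eq_tsum, hb.tsum_mul_tsum hc hbc,
    ha.tsum_mul_tsum hbc habc]
  exact habc.hasSum

/-- Multiplication of a family by unimodular numbers. -/
def rotate (θ : ι → ℝ) (a : SummableSeq ι) : SummableSeq ι :=
  mk (fun i => Complex.exp (Complex.I * θ i) * a i) <| by
    simpa [mul_comm Complex.I, Complex.norm_exp_ofReal_mul_I] using a.summable_norm

@[simp]
theorem rotate_apply (θ : ι → ℝ) (a : SummableSeq ι) (i : ι) :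
    rotate θ a i = Complex.exp (Complex.I * θ i) * a i := rfl

theorem norm_exp_I_mul (x : ℝ) : ‖Complex.exp (Complex.I * x)‖ = 1 := by
  rw [mul_comm, Complex.norm_exp_ofReal_mul_I]

theorem norm_rotate (θ : ι → ℝ) (a : SummableSeq ι) : ‖rotate θ a‖ = ‖a‖ := by
  simp only [norm_eq_tsum, rotate_apply, norm_mul, norm_exp_I_mul, one_mul]

theorem rotate_sub (θ : ι → ℝ) (a b : SummableSeq ι) :
    rotate θ (a - b) = rotate θ a - rotate θ b := by
  ext i
  simp [mul_sub]

/-- Dominated convergence with majorant 2|a_i|. Since Λ may be unbounded, continuity holds for each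
fixed `a` but need not be uniform on balls. -/
theorem continuous_rotate (Λ : ι → ℝ) (a : SummableSeq ι) :
    Continuous fun t : ℝ => rotate (fun i => Λ i * t) a := by
  classical
  refine continuous_iff_continuousAt.2 fun t₀ => tendsto_iff_norm_sub_tendsto_zero.2 ?_
  have h0 : (0 : ℝ) = ∑' i, ‖rotate (fun i => Λ i * t₀) a i - rotate (fun i => Λ i * t₀) a i‖ := by
    simp
  rw [h0]
  simp only [norm_eq_tsum, lp.coeFn_sub, Pi.sub_apply]
  refine tendsto_tsum_of_dominated_convergence (bound := fun i => 2 * ‖a i‖)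
    (a.summable_norm.mul_left 2) (fun i => ?_) (Eventually.of_forall fun t i => ?_)
  · have : Continuous fun t : ℝ => ‖rotate (fun i => Λ i * t) a i - rotate (fun i => Λ i * t₀) a i‖ := by
      simp only [rotate_apply]
      fun_prop
    exact this.tendsto t₀
  · rw [norm_norm]
    refine (norm_sub_le _ _).trans ?_
    simp only [rotate_apply, norm_mul, norm_exp_I_mul]
    linarith

/-- Rotations are isometries, so the variation of `v` and that of the rotation at the frozen vector
`v t₀` can be estimated separately. -/
theorem continuousWithinAt_rotate (Λ : ι → ℝ) {v : ℝ → SummableSeq ι} {s : Set ℝ} {t₀ : ℝ}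
    (hv : ContinuousWithinAt v s t₀) :
    ContinuousWithinAt (fun t => rotate (fun i => Λ i * t) (v t)) s t₀ := by
  refine tendsto_iff_norm_sub_tendsto_zero.2 ?_
  have h1 := tendsto_iff_norm_sub_tendsto_zero.1 hv
  have h2 := tendsto_iff_norm_sub_tendsto_zero.1
    ((continuous_rotate Λ (v t₀)).continuousWithinAt (s := s) (x := t₀))
  refine squeeze_zero (fun _ => norm_nonneg _) (fun t => ?_) (by simpa using h1.add h2)
  rw [← norm_rotate (fun i => Λ i * t) (v t - v t₀), rotate_sub]
  exact norm_sub_le_norm_sub_add_norm_sub _ _ _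

theorem _root_.HasSum.mul_conj_mul {f : ι → ℂ} {z : ℂ} (hf : HasSum f z)
    (hn : Summable fun i => ‖f i‖) :
    HasSum (fun x : ι × ι × ι => f x.1 * (conj (f x.2.1) * f x.2.2)) (z * (conj z * z)) := by
  have hc : Summable fun i => ‖conj (f i)‖ := by
    simpa only [RCLike.norm_conj] using hn
  have hcn : Summable fun p : ι × ι => ‖conj (f p.1) * f p.2‖ :=
    Summable.mul_norm (f := fun i => conj (f i)) hc hn
  have h2 : HasSum (fun p : ι × ι => conj (f p.1) * f p.2) (conj z * z) :=
    HasSum.mul (f := fun i => conj (f i)) (Complex.hasSum_conj'.2 hf) hf hcn.of_norm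
  exact HasSum.mul (g := fun p : ι × ι => conj (f p.1) * f p.2) hf h2
    (Summable.mul_norm (g := fun p : ι × ι => conj (f p.1) * f p.2) hn hcn).of_norm

end SummableSeq

/-! ### The cubic convolution in Fourier space -/

section Cubic

open SummableSeq

variable {ι : Type*} [AddCommGroup ι]

/-- A submultiplicative weight. -/
structure IsSubmultWeight (w : ι → ℝ) : Prop where
  one_le : ∀ k, 1 ≤ w k
  add_le : ∀ j k, w (j + k) ≤ w j * w k
  neg_eq : ∀ k, w (-k) = w k

theorem IsSubmultWeight.pos {w : ι → ℝ} (hw : IsSubmultWeight w) (k : ι) : 0 < w k :=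
  zero_lt_one.trans_le (hw.one_le k)


/-- The frequency produced by the interaction of `j`, `k` and `l` in `|ψ|²ψ`. -/
def outFreq (x : ι × ι × ι) : ι := x.1 - x.2.1 + x.2.2

/-- The phase `Λ_j - Λ_k + Λ_l - Λ_{j-k+l}` of an interaction. -/
def phase (Λ : ι → ℝ) (x : ι × ι × ι) : ℝ := Λ x.1 - Λ x.2.1 + Λ x.2.2 - Λ (outFreq x)

/-- The ratio of the weights of an interaction. -/
def weightRatio (w : ι → ℝ) (x : ι × ι × ι) : ℝ :=
  w (outFreq x) / (w x.1 * w x.2.1 * w x.2.2)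

theorem weightRatio_pos {w : ι → ℝ} (hw : IsSubmultWeight w) (x : ι × ι × ι) :
    0 < weightRatio w x :=
  div_pos (hw.pos _) (mul_pos (mul_pos (hw.pos _) (hw.pos _)) (hw.pos _))

/-- This is what submultiplicativity is for: in weighted coefficients the cubic convolution is
trilinear on ℓ¹ with norm at most 1. -/
theorem weightRatio_le_one {w : ι → ℝ} (hw : IsSubmultWeight w) (x : ι × ι × ι) :
    weightRatio w x ≤ 1 := by
  refine div_le_one_of_le₀ ?_ (mul_pos (mul_pos (hw.pos _) (hw.pos _)) (hw.pos _)).le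
  rw [outFreq]
  refine (hw.add_le _ _).trans (mul_le_mul_of_nonneg_right ?_ (hw.pos _).le)
  rw [sub_eq_add_neg, ← hw.neg_eq x.2.1]
  exact hw.add_le _ _

/-- The kernel of the cubic Schrödinger equation in the interaction picture. -/
def nlsKernel (w Λ : ι → ℝ) (t : ℝ) (x : ι × ι × ι) : ℂ :=
  Complex.I * weightRatio w x * Complex.exp (Complex.I * (phase Λ x * t : ℝ))

theorem norm_nlsKernel {w : ι → ℝ} (hw : IsSubmultWeight w) (Λ : ι → ℝ) (t : ℝ)
    (x : ι × ι × ι) : ‖nlsKernel w Λ t x‖ = weightRatio w x := by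
  rw [nlsKernel, norm_mul, norm_mul, norm_exp_I_mul, Complex.norm_I, Complex.norm_real,
    Real.norm_of_nonneg (weightRatio_pos hw x).le, one_mul, mul_one]

theorem norm_nlsKernel_le {w : ι → ℝ} (hw : IsSubmultWeight w) (Λ : ι → ℝ) (t : ℝ)
    (x : ι × ι × ι) : ‖nlsKernel w Λ t x‖ ≤ 1 :=
  (norm_nlsKernel hw Λ t x).trans_le (weightRatio_le_one hw x)

theorem hasDerivAt_nlsKernel (w Λ : ι → ℝ) (t : ℝ) (x : ι × ι × ι) :
    HasDerivAt (fun t => nlsKernel w Λ t x) (nlsKernel w Λ t x * (Complex.I * phase Λ x)) t := by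
  have h : HasDerivAt (fun t : ℝ => Complex.I * ((phase Λ x * t : ℝ) : ℂ))
      (Complex.I * phase Λ x) t := by
    have := (((hasDerivAt_id t).const_mul (phase Λ x)).ofReal_comp).const_mul Complex.I
    simpa using this
  refine (h.cexp.const_mul (Complex.I * (weightRatio w x : ℂ))).congr_deriv ?_
  rw [nlsKernel]
  ring

variable [DecidableEq ι]

/-- A single interaction of the cubic nonlinearity with kernel `κ`. -/
def cubicTerm (κ : ι × ι × ι → ℂ) (a b c : SummableSeq ι) (x : ι × ι × ι) : SummableSeq ι :=
  lp.single 1 (outFreq x) (κ x * (a x.1 * conj (b x.2.1) * c x.2.2))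

/-- The cubic convolution `(a, b, c) ↦ ∑ κ(j,k,l) a_j b̄_k c_l δ_{j-k+l}`. -/
def cubicSum (κ : ι × ι × ι → ℂ) (a b c : SummableSeq ι) : SummableSeq ι :=
  ∑' x, cubicTerm κ a b c x

variable {κ : ι × ι × ι → ℂ}

theorem norm_cubicTerm_le (hκ : ∀ x, ‖κ x‖ ≤ 1) (a b c : SummableSeq ι) (x : ι × ι × ι) :
    ‖cubicTerm κ a b c x‖ ≤ ‖a x.1‖ * (‖b x.2.1‖ * ‖c x.2.2‖) := by
  rw [cubicTerm, lp.norm_single (by simp), norm_mul, norm_mul, norm_mul, RCLike.norm_conj,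
    mul_assoc ‖a x.1‖]
  exact mul_le_of_le_one_left (by positivity) (hκ x)

theorem summable_norm_cubicTerm (hκ : ∀ x, ‖κ x‖ ≤ 1) (a b c : SummableSeq ι) :
    Summable fun x => ‖cubicTerm κ a b c x‖ :=
  Summable.of_nonneg_of_le (fun _ => norm_nonneg _) (norm_cubicTerm_le hκ a b c)
    (hasSum_norm_mul_mul a b c).summable

theorem hasSum_cubicTerm (hκ : ∀ x, ‖κ x‖ ≤ 1) (a b c : SummableSeq ι) :
    HasSum (cubicTerm κ a b c) (cubicSum κ a b c) :=
  (summable_norm_cubicTerm hκ a b c).of_norm.hasSum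

theorem hasSum_cubicTerm_apply (hκ : ∀ x, ‖κ x‖ ≤ 1) (a b c : SummableSeq ι) (i : ι) :
    HasSum (fun x => cubicTerm κ a b c x i) (cubicSum κ a b c i) :=
  (hasSum_cubicTerm hκ a b c).mapL (lp.evalCLM ℂ (fun _ : ι => ℂ) 1 i)

theorem norm_cubicSum_le (hκ : ∀ x, ‖κ x‖ ≤ 1) (a b c : SummableSeq ι) :
    ‖cubicSum κ a b c‖ ≤ ‖a‖ * (‖b‖ * ‖c‖) := by
  refine (norm_tsum_le_tsum_norm (summable_norm_cubicTerm hκ a b c)).trans ?_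
  rw [← (hasSum_norm_mul_mul a b c).tsum_eq]
  exact (summable_norm_cubicTerm hκ a b c).tsum_le_tsum (norm_cubicTerm_le hκ a b c)
    (hasSum_norm_mul_mul a b c).summable

/-- Telescoping, one slot at a time; this is the source of the Lipschitz constant 3R². -/
theorem cubicSum_sub (hκ : ∀ x, ‖κ x‖ ≤ 1) (a b : SummableSeq ι) :
    cubicSum κ a a a - cubicSum κ b b b =
      cubicSum κ (a - b) a a + cubicSum κ b (a - b) a + cubicSum κ b b (a - b) := by
  refine ((hasSum_cubicTerm hκ a a a).sub (hasSum_cubicTerm hκ b b b)).unique ?_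
  convert! ((hasSum_cubicTerm hκ (a - b) a a).add (hasSum_cubicTerm hκ b (a - b) a)).add
    (hasSum_cubicTerm hκ b b (a - b)) using 2 with x
  simp only [cubicTerm, ← lp.single_sub, ← lp.single_add, lp.coeFn_sub, Pi.sub_apply, map_sub]
  congr 1
  ring

theorem norm_cubicSum_sub_le (hκ : ∀ x, ‖κ x‖ ≤ 1) {a b : SummableSeq ι} {R : ℝ}
    (ha : ‖a‖ ≤ R) (hb : ‖b‖ ≤ R) :
    ‖cubicSum κ a a a - cubicSum κ b b b‖ ≤ 3 * R ^ 2 * ‖a - b‖ := by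
  have hR : 0 ≤ R := (norm_nonneg a).trans ha
  rw [cubicSum_sub hκ]
  have h1 : ‖cubicSum κ (a - b) a a‖ ≤ ‖a - b‖ * (R * R) :=
    (norm_cubicSum_le hκ _ _ _).trans (by gcongr)
  have h2 : ‖cubicSum κ b (a - b) a‖ ≤ R * (‖a - b‖ * R) :=
    (norm_cubicSum_le hκ _ _ _).trans (by gcongr)
  have h3 : ‖cubicSum κ b b (a - b)‖ ≤ R * (R * ‖a - b‖) :=
    (norm_cubicSum_le hκ _ _ _).trans (by gcongr)
  refine (norm_add₃_le).trans ?_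
  linarith

theorem continuous_cubicSum {κ : ℝ → ι × ι × ι → ℂ} (hκ : ∀ t x, ‖κ t x‖ ≤ 1)
    (hcont : ∀ x, Continuous fun t => κ t x) (a b c : SummableSeq ι) :
    Continuous fun t => cubicSum (κ t) a b c := by
  refine continuous_tsum (fun x => ?_) (hasSum_norm_mul_mul a b c).summable
    fun x t => norm_cubicTerm_le (hκ t) a b c x
  exact (lp.isometry_single (E := fun _ : ι => ℂ) (p := 1) (outFreq x)).continuous.comp
    ((hcont x).mul continuous_const)

/-- The vector field of the cubic Schrödinger equation in the interaction picture, acting on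
weighted Fourier coefficients. -/
def nlsField (w Λ : ι → ℝ) (t : ℝ) (a : SummableSeq ι) : SummableSeq ι :=
  cubicSum (nlsKernel w Λ t) a a a

theorem norm_nlsField_le {w : ι → ℝ} (hw : IsSubmultWeight w) (Λ : ι → ℝ) (t : ℝ)
    {a : SummableSeq ι} {R : ℝ} (ha : ‖a‖ ≤ R) : ‖nlsField w Λ t a‖ ≤ R ^ 3 := by
  have hR : 0 ≤ R := (norm_nonneg a).trans ha
  refine (norm_cubicSum_le (norm_nlsKernel_le hw Λ t) a a a).trans ?_
  calc ‖a‖ * (‖a‖ * ‖a‖) ≤ R * (R * R) := by gcongr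
    _ = R ^ 3 := by ring

theorem norm_nlsField_sub_le {w : ι → ℝ} (hw : IsSubmultWeight w) (Λ : ι → ℝ) (t : ℝ)
    {a b : SummableSeq ι} {R : ℝ} (ha : ‖a‖ ≤ R) (hb : ‖b‖ ≤ R) :
    ‖nlsField w Λ t a - nlsField w Λ t b‖ ≤ 3 * R ^ 2 * ‖a - b‖ :=
  norm_cubicSum_sub_le (norm_nlsKernel_le hw Λ t) ha hb

theorem continuous_nlsField {w : ι → ℝ} (hw : IsSubmultWeight w) (Λ : ι → ℝ)
    (a : SummableSeq ι) : Continuous fun t => nlsField w Λ t a :=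
  continuous_cubicSum (norm_nlsKernel_le hw Λ)
    (fun x => by unfold nlsKernel; fun_prop) a a a

end Cubic

/-! ### Weighted Fourier series on the torus -/

section Torus

open SummableSeq UnitAddTorus

variable {w : (Fin 2 → ℤ) → ℝ}

/-- The monomial of frequency `k` as an element of `L²`. -/
def monomialL2 (k : Fin 2 → ℤ) : L2Torus := ContinuousMap.toLp 2 torusMeasure ℂ (mFourier k)

theorem mFourierCoeff_eq_inner (f : L2Torus) (k : Fin 2 → ℤ) :
    mFourierCoeff f k = inner ℂ (monomialL2 k) f := by
  have h := mFourierBasis_repr f k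
  rw [HilbertBasis.repr_apply_apply, coe_mFourierBasis] at h
  exact h.symm

theorem orthonormal_monomialL2 : Orthonormal ℂ monomialL2 :=
  orthonormal_mFourier (d := Fin 2)

theorem norm_mFourierCoeff_le (f : L2Torus) (k : Fin 2 → ℤ) : ‖mFourierCoeff f k‖ ≤ ‖f‖ := by
  rw [mFourierCoeff_eq_inner]
  refine (norm_inner_le_norm _ _).trans_eq ?_
  rw [orthonormal_monomialL2.1 k, one_mul]

theorem mFourierCoeff_sub (f g : L2Torus) (k : Fin 2 → ℤ) :
    mFourierCoeff (f - g : L2Torus) k = mFourierCoeff f k - mFourierCoeff g k := by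
  simp only [mFourierCoeff_eq_inner, inner_sub_right]

theorem mFourierCoeff_congr {f g : Torus2 → ℂ} (h : f =ᵐ[torusMeasure] g) (k : Fin 2 → ℤ) :
    mFourierCoeff f k = mFourierCoeff g k :=
  integral_congr_ae (h.mono fun x hx => by simp only [hx])

theorem ext_mFourierCoeff {f g : L2Torus} (h : ∀ k, mFourierCoeff f k = mFourierCoeff g k) :
    f = g := by
  refine mFourierBasis.repr.injective (lp.ext (funext fun k => ?_))
  exact (mFourierBasis_repr f k).trans ((h k).trans (mFourierBasis_repr g k).symm)

theorem hasSum_norm_sq_mFourierCoeff (f : L2Torus) :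
    HasSum (fun k => ‖mFourierCoeff f k‖ ^ 2) (‖f‖ ^ 2) := by
  have h := hasSum_sq_mFourierCoeff f
  have h2 : ‖f‖ ^ 2 = ∫ t, ‖f t‖ ^ 2 ∂torusMeasure := by
    have := @inner_self_eq_norm_sq ℂ L2Torus _ _ _ f
    rw [← this, MeasureTheory.L2.inner_def, ← integral_re (L2.integrable_inner f f)]
    simp only [inner_self_eq_norm_sq]
  rw [h2]
  exact h

theorem norm_weighted_mFourier_le (hw : IsSubmultWeight w) (k : Fin 2 → ℤ) :
    ‖((w k : ℂ)⁻¹) • (mFourier k : C(Torus2, ℂ))‖ ≤ 1 := by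
  rw [norm_smul, mFourier_norm, mul_one, norm_inv, Complex.norm_real,
    Real.norm_of_nonneg (hw.pos k).le]
  exact inv_le_one_of_one_le₀ (hw.one_le k)

/-- The continuous function with Fourier coefficients `a_k / w_k`. -/
def fourierSeries (hw : IsSubmultWeight w) : SummableSeq (Fin 2 → ℤ) →L[ℂ] C(Torus2, ℂ) :=
  lift (fun k => ((w k : ℂ)⁻¹) • (mFourier k : C(Torus2, ℂ))) 1 (norm_weighted_mFourier_le hw)

/-- The `L²` function with Fourier coefficients `a_k / w_k`. -/
def fourierSeriesL2 (hw : IsSubmultWeight w) : SummableSeq (Fin 2 → ℤ) →L[ℂ] L2Torus :=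
  (ContinuousMap.toLp 2 torusMeasure ℂ).comp (fourierSeries hw)

theorem coeFn_fourierSeriesL2 (hw : IsSubmultWeight w) (a : SummableSeq (Fin 2 → ℤ)) :
    fourierSeriesL2 hw a =ᵐ[torusMeasure] fourierSeries hw a :=
  ContinuousMap.coeFn_toLp torusMeasure _

theorem hasSum_fourierSeries (hw : IsSubmultWeight w) (a : SummableSeq (Fin 2 → ℤ)) :
    HasSum (fun k => a k • ((w k : ℂ)⁻¹) • (mFourier k : C(Torus2, ℂ))) (fourierSeries hw a) :=
  lift_hasSum _ 1 _ a

theorem fourierSeries_single (hw : IsSubmultWeight w) (k : Fin 2 → ℤ) (z : ℂ) :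
    fourierSeries hw (lp.single 1 k z) = z • ((w k : ℂ)⁻¹) • (mFourier k : C(Torus2, ℂ)) :=
  lift_single _ 1 (norm_weighted_mFourier_le hw) k z

theorem fourierSeriesL2_single (hw : IsSubmultWeight w) (k : Fin 2 → ℤ) (z : ℂ) :
    fourierSeriesL2 hw (lp.single 1 k z) = (z * (w k : ℂ)⁻¹) • monomialL2 k := by
  rw [fourierSeriesL2, ContinuousLinearMap.comp_apply, fourierSeries_single, smul_smul, map_smul]
  rfl

theorem mFourierCoeff_fourierSeriesL2 (hw : IsSubmultWeight w) (a : SummableSeq (Fin 2 → ℤ))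
    (k : Fin 2 → ℤ) : mFourierCoeff (fourierSeriesL2 hw a) k = a k * (w k : ℂ)⁻¹ := by
  rw [mFourierCoeff_eq_inner]
  have h := (lp.hasSum_single (by simp) a).mapL
    ((innerSL ℂ (monomialL2 k)).comp (fourierSeriesL2 hw))
  simp only [ContinuousLinearMap.comp_apply, fourierSeriesL2_single, innerSL_apply_apply,
    inner_smul_right, orthonormal_iff_ite.1 orthonormal_monomialL2] at h
  refine h.unique ?_
  convert! hasSum_ite_eq k (a k * (w k : ℂ)⁻¹) using 2 with j
  by_cases hj : j = k
  · simp [hj]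
  · simp [hj, Ne.symm hj]

theorem mFourierCoeff_fourierSeries (hw : IsSubmultWeight w) (a : SummableSeq (Fin 2 → ℤ))
    (k : Fin 2 → ℤ) : mFourierCoeff (fourierSeries hw a) k = a k * (w k : ℂ)⁻¹ := by
  rw [← mFourierCoeff_fourierSeriesL2 hw a, mFourierCoeff_congr (coeFn_fourierSeriesL2 hw a)]

theorem norm_weightRatio_le (hw : IsSubmultWeight w)
    (x : (Fin 2 → ℤ) × (Fin 2 → ℤ) × (Fin 2 → ℤ)) : ‖(weightRatio w x : ℂ)‖ ≤ 1 := by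
  rw [Complex.norm_real, Real.norm_of_nonneg (weightRatio_pos hw x).le]
  exact weightRatio_le_one hw x

theorem hasSum_fourierSeries_apply (hw : IsSubmultWeight w) (a : SummableSeq (Fin 2 → ℤ))
    (y : Torus2) :
    HasSum (fun k => a k * (w k : ℂ)⁻¹ * mFourier k y) (fourierSeries hw a y) := by
  have h := (hasSum_fourierSeries hw a).mapL (ContinuousMap.evalCLM ℂ y)
  simpa [mul_assoc] using h

theorem summable_norm_fourierSeries_apply (hw : IsSubmultWeight w)
    (a : SummableSeq (Fin 2 → ℤ)) (y : Torus2) :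
    Summable fun k => ‖a k * (w k : ℂ)⁻¹ * mFourier k y‖ := by
  refine Summable.of_nonneg_of_le (fun _ => norm_nonneg _) (fun k => ?_) a.summable_norm
  have h1 : ‖(w k : ℂ)⁻¹‖ ≤ 1 := by
    rw [norm_inv, Complex.norm_real, Real.norm_of_nonneg (hw.pos k).le]
    exact inv_le_one_of_one_le₀ (hw.one_le k)
  have h2 : ‖mFourier k y‖ ≤ 1 := (ContinuousMap.norm_coe_le_norm _ y).trans_eq mFourier_norm
  rw [norm_mul, norm_mul, mul_assoc]
  exact mul_le_of_le_one_right (norm_nonneg _) (mul_le_one₀ h1 (norm_nonneg _) h2)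

theorem fourierSeries_cubicTerm_apply (hw : IsSubmultWeight w) (a : SummableSeq (Fin 2 → ℤ))
    (x : (Fin 2 → ℤ) × (Fin 2 → ℤ) × (Fin 2 → ℤ)) (y : Torus2) :
    fourierSeries hw (cubicTerm (fun x => (weightRatio w x : ℂ)) a a a x) y =
      a x.1 * (w x.1 : ℂ)⁻¹ * mFourier x.1 y *
        (conj (a x.2.1 * (w x.2.1 : ℂ)⁻¹ * mFourier x.2.1 y) *
          (a x.2.2 * (w x.2.2 : ℂ)⁻¹ * mFourier x.2.2 y)) := by
  have hm : mFourier (outFreq x) y =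
      mFourier x.1 y * conj (mFourier x.2.1 y) * mFourier x.2.2 y := by
    rw [outFreq, sub_eq_add_neg, mFourier_add, mFourier_add, mFourier_neg]
  have hne := fun k => Complex.ofReal_ne_zero.2 (hw.pos k).ne'
  rw [cubicTerm, fourierSeries_single]
  simp only [ContinuousMap.smul_apply, smul_eq_mul, hm, weightRatio, map_mul, map_inv₀,
    Complex.conj_ofReal]
  push_cast
  have h1 := hne x.1
  have h2 := hne x.2.1
  have h3 := hne x.2.2
  have h4 := hne (outFreq x)
  field_simp

/-- The weight ratio undoes the weights of the three factors and restores that of the output, so the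
sum is the product of the series f, f̄ and f at each point. -/
theorem fourierSeries_cubicSum (hw : IsSubmultWeight w) (a : SummableSeq (Fin 2 → ℤ))
    (y : Torus2) :
    fourierSeries hw (cubicSum (fun x => (weightRatio w x : ℂ)) a a a) y =
      ((‖fourierSeries hw a y‖ ^ 2 : ℝ) : ℂ) * fourierSeries hw a y := by
  have h : HasSum _ (fourierSeries hw (cubicSum (fun x => (weightRatio w x : ℂ)) a a a) y) :=
    ((hasSum_cubicTerm (norm_weightRatio_le hw) a a a).mapL (fourierSeries hw)).mapL
      (ContinuousMap.evalCLM ℂ y)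
  simp only [ContinuousMap.evalCLM_apply, fourierSeries_cubicTerm_apply] at h
  rw [h.unique ((hasSum_fourierSeries_apply hw a y).mul_conj_mul
    (summable_norm_fourierSeries_apply hw a y)), ← mul_assoc, Complex.mul_conj,
    Complex.normSq_eq_norm_sq]

theorem mFourierCoeff_norm_sq_mul (hw : IsSubmultWeight w) (a : SummableSeq (Fin 2 → ℤ))
    {f : Torus2 → ℂ} (hf : f =ᵐ[torusMeasure] fourierSeries hw a) (k : Fin 2 → ℤ) :
    mFourierCoeff (fun y => ((‖f y‖ ^ 2 : ℝ) : ℂ) * f y) k =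
      cubicSum (fun x => (weightRatio w x : ℂ)) a a a k * (w k : ℂ)⁻¹ := by
  rw [← mFourierCoeff_fourierSeries hw]
  refine mFourierCoeff_congr (hf.mono fun y hy => ?_) k
  simp only [hy, fourierSeries_cubicSum]

/-- The bridge between the interaction picture and (NLS): the factor e^{iΛ_k t} cancels the output
frequency in the phase, and the three remaining exponentials rotate the three inputs. -/
theorem rotate_nlsField (hw : IsSubmultWeight w) (Λ : (Fin 2 → ℤ) → ℝ) (t : ℝ)
    (a : SummableSeq (Fin 2 → ℤ)) (k : Fin 2 → ℤ) :
    Complex.exp (Complex.I * (Λ k * t : ℝ)) * nlsField w Λ t a k =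
      Complex.I * cubicSum (fun x => (weightRatio w x : ℂ)) (rotate (fun i => Λ i * t) a)
        (rotate (fun i => Λ i * t) a) (rotate (fun i => Λ i * t) a) k := by
  have h1 := (hasSum_cubicTerm_apply (norm_nlsKernel_le hw Λ t) a a a k).mul_left
    (Complex.exp (Complex.I * (Λ k * t : ℝ)))
  have h2 := (hasSum_cubicTerm_apply (norm_weightRatio_le hw) (rotate (fun i => Λ i * t) a)
    (rotate (fun i => Λ i * t) a) (rotate (fun i => Λ i * t) a) k).mul_left Complex.I
  refine h1.unique ?_
  convert! h2 using 2 with x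
  by_cases hk : outFreq x = k
  · subst hk
    simp only [cubicTerm, lp.single_apply_self, nlsKernel, rotate_apply, map_mul,
      ← Complex.exp_conj, Complex.conj_I, Complex.conj_ofReal]
    have e : Complex.exp (Complex.I * (Λ (outFreq x) * t : ℝ)) *
        Complex.exp (Complex.I * (phase Λ x * t : ℝ)) =
        Complex.exp (Complex.I * (Λ x.1 * t : ℝ)) * Complex.exp (-Complex.I * (Λ x.2.1 * t : ℝ)) *
          Complex.exp (Complex.I * (Λ x.2.2 * t : ℝ)) := by
      rw [← Complex.exp_add, ← Complex.exp_add, ← Complex.exp_add, phase]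
      congr 1
      push_cast
      ring
    linear_combination (Complex.I * (weightRatio w x : ℂ) *
      (a x.1 * conj (a x.2.1) * a x.2.2)) * e
  · rw [cubicTerm, cubicTerm, lp.single_apply_ne _ _ _ (Ne.symm hk),
      lp.single_apply_ne _ _ _ (Ne.symm hk), mul_zero, mul_zero]

/-! ### Conservation of mass -/

/-- The symmetry of the quadruples `(j, k, l, j - k + l)` that exchanges `j`, `l` with
`k`, `j - k + l`. -/
def interactionSwap : Equiv.Perm ((Fin 2 → ℤ) × (Fin 2 → ℤ) × (Fin 2 → ℤ)) where
  toFun x := (x.2.1, x.1, outFreq x)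
  invFun x := (x.2.1, x.1, outFreq x)
  left_inv x := by
    ext1
    · rfl
    · ext1
      · rfl
      · simp only [outFreq]
        abel
  right_inv x := by
    ext1
    · rfl
    · ext1
      · rfl
      · simp only [outFreq]
        abel

/-- The weights cancel, and the inner product is i times a sum over quadruples. `interactionSwap`
reverses the phase and conjugates each term, so the sum is real. -/
theorem re_inner_nlsField (hw : IsSubmultWeight w) (Λ : (Fin 2 → ℤ) → ℝ) (t : ℝ)
    (a : SummableSeq (Fin 2 → ℤ)) :
    (inner ℂ (fourierSeriesL2 hw a) (fourierSeriesL2 hw (nlsField w Λ t a))).re = 0 := by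
  set u : (Fin 2 → ℤ) → ℂ := fun k => a k * (w k : ℂ)⁻¹
  set T : (Fin 2 → ℤ) × (Fin 2 → ℤ) × (Fin 2 → ℤ) → ℂ := fun x =>
    Complex.exp (Complex.I * (phase Λ x * t : ℝ)) *
      (u x.1 * conj (u x.2.1) * u x.2.2 * conj (u (outFreq x))) with hT
  have h := ((hasSum_cubicTerm (norm_nlsKernel_le hw Λ t) a a a).mapL (fourierSeriesL2 hw)).mapL
    (innerSL ℂ (fourierSeriesL2 hw a))
  have hterm : ∀ x, innerSL ℂ (fourierSeriesL2 hw a)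
      (fourierSeriesL2 hw (cubicTerm (nlsKernel w Λ t) a a a x)) = Complex.I * T x := by
    intro x
    have hne := fun k => Complex.ofReal_ne_zero.2 (hw.pos k).ne'
    rw [cubicTerm, fourierSeriesL2_single, innerSL_apply_apply, inner_smul_right,
      ← inner_conj_symm, ← mFourierCoeff_eq_inner, mFourierCoeff_fourierSeriesL2]
    simp only [nlsKernel, weightRatio, hT, u, map_mul, map_inv₀, Complex.conj_ofReal]
    push_cast
    have h1 := hne x.1
    have h2 := hne x.2.1
    have h3 := hne x.2.2
    have h4 := hne (outFreq x)
    field_simp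
  simp only [hterm] at h
  have hsum : HasSum T (-Complex.I * inner ℂ (fourierSeriesL2 hw a)
      (fourierSeriesL2 hw (nlsField w Λ t a))) := by
    have := h.mul_left (-Complex.I)
    simp only [← mul_assoc, neg_mul, Complex.I_mul_I, neg_neg, one_mul] at this
    simpa [nlsField] using this
  have hconj : ∀ x, T (interactionSwap x) = conj (T x) := by
    intro x
    have h1 : outFreq (interactionSwap x) = x.2.2 := by
      simp only [interactionSwap, outFreq, Equiv.coe_fn_mk]
      abel
    have h2 : phase Λ (interactionSwap x) = -phase Λ x := by
      simp only [phase, h1]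
      simp only [interactionSwap, Equiv.coe_fn_mk]
      ring
    simp only [hT, h1, h2, map_mul, ← Complex.exp_conj, Complex.conj_I, Complex.conj_ofReal,
      Complex.conj_conj]
    simp only [interactionSwap, Equiv.coe_fn_mk]
    push_cast
    ring_nf
  have hs2 := (interactionSwap.hasSum_iff.2 hsum)
  have hs3 := Complex.hasSum_conj'.2 hsum
  have heq := hs2.unique (by simpa only [Function.comp_def, hconj] using hs3)
  have him := congrArg Complex.im heq
  rw [Complex.conj_im, neg_mul, Complex.neg_im, Complex.I_mul_im] at him
  linarith

end Torus

/-! ### The truncated equation -/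

section Truncation

theorem HasDerivWithinAt.Ici_of_Icc {F : Type*} [NormedAddCommGroup F] [NormedSpace ℝ F]
    {f : ℝ → F} {f' : F} {a b t : ℝ} (h : HasDerivWithinAt f f' (Set.Icc a b) t)
    (ht : t ∈ Set.Ico a b) : HasDerivWithinAt f f' (Set.Ici t) t :=
  h.mono_of_mem_nhdsWithin (mem_of_superset (Icc_mem_nhdsGE ht.2) (Set.Icc_subset_Icc_left ht.1))

variable {E : Type*} [NormedAddCommGroup E]

/-- A Lipschitz cutoff, equal to `1` on the ball of radius `R` and to `0` outside the ball of
radius `2R`. -/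
def cutoff (R : ℝ) (a : E) : ℝ := max 0 (min 1 (2 - ‖a‖ / R))

theorem cutoff_nonneg (R : ℝ) (a : E) : 0 ≤ cutoff R a := le_max_left _ _

theorem cutoff_le_one (R : ℝ) (a : E) : cutoff R a ≤ 1 :=
  max_le zero_le_one (min_le_left _ _)

theorem cutoff_eq_one {R : ℝ} (hR : 0 < R) {a : E} (ha : ‖a‖ ≤ R) : cutoff R a = 1 := by
  have : ‖a‖ / R ≤ 1 := (div_le_one hR).2 ha
  rw [cutoff, min_eq_left (by linarith), max_eq_right zero_le_one]

theorem cutoff_eq_zero {R : ℝ} (hR : 0 < R) {a : E} (ha : 2 * R ≤ ‖a‖) : cutoff R a = 0 := by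
  have : 2 ≤ ‖a‖ / R := (le_div_iff₀ hR).2 ha
  rw [cutoff, max_eq_left ((min_le_right _ _).trans (by linarith))]

theorem abs_cutoff_sub_le {R : ℝ} (hR : 0 < R) (a b : E) :
    |cutoff R a - cutoff R b| ≤ ‖a - b‖ / R := by
  refine (abs_max_sub_max_le_max _ _ _ _).trans ?_
  rw [sub_self, abs_zero]
  refine max_le (by positivity) ((abs_min_sub_min_le_max _ _ _ _).trans ?_)
  rw [sub_self, abs_zero]
  refine max_le (by positivity) ?_
  have : 2 - ‖a‖ / R - (2 - ‖b‖ / R) = -((‖a‖ - ‖b‖) / R) := by ring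
  rw [this, abs_neg, abs_div, abs_of_pos hR]
  gcongr
  exact abs_norm_sub_norm_le a b

variable {ι : Type*} [AddCommGroup ι] [DecidableEq ι] {w : ι → ℝ}

theorem norm_cutoff_smul_nlsField_le (hw : IsSubmultWeight w) (Λ : ι → ℝ) {R : ℝ} (hR : 0 < R)
    (t : ℝ) (a : SummableSeq ι) : ‖cutoff R a • nlsField w Λ t a‖ ≤ (2 * R) ^ 3 := by
  rcases le_total (2 * R) ‖a‖ with h | h
  · rw [cutoff_eq_zero hR h, zero_smul, norm_zero]
    positivity
  · rw [norm_smul, Real.norm_of_nonneg (cutoff_nonneg R a)]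
    exact (mul_le_of_le_one_left (norm_nonneg _) (cutoff_le_one R a)).trans
      (norm_nlsField_le hw Λ t h)

theorem norm_cutoff_smul_nlsField_sub_le (hw : IsSubmultWeight w) (Λ : ι → ℝ) {R B : ℝ}
    (hR : 0 < R) (t : ℝ) {a b : SummableSeq ι} (ha : ‖a‖ ≤ B) (hb : ‖b‖ ≤ B) :
    ‖cutoff R a • nlsField w Λ t a - cutoff R b • nlsField w Λ t b‖ ≤
      (B ^ 3 / R + 3 * B ^ 2) * ‖a - b‖ := by
  have hB : 0 ≤ B := (norm_nonneg a).trans ha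
  have e : cutoff R a • nlsField w Λ t a - cutoff R b • nlsField w Λ t b =
      (cutoff R a - cutoff R b) • nlsField w Λ t a +
        cutoff R b • (nlsField w Λ t a - nlsField w Λ t b) := by
    rw [sub_smul, smul_sub]
    abel
  have h1 : ‖(cutoff R a - cutoff R b) • nlsField w Λ t a‖ ≤ ‖a - b‖ / R * B ^ 3 := by
    rw [norm_smul]
    exact mul_le_mul (abs_cutoff_sub_le hR a b) (norm_nlsField_le hw Λ t ha) (norm_nonneg _)
      (by positivity)
  have h2 : ‖cutoff R b • (nlsField w Λ t a - nlsField w Λ t b)‖ ≤ 3 * B ^ 2 * ‖a - b‖ := by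
    rw [norm_smul, Real.norm_of_nonneg (cutoff_nonneg R b)]
    exact (mul_le_of_le_one_left (norm_nonneg _) (cutoff_le_one R b)).trans
      (norm_nlsField_sub_le hw Λ t ha hb)
  rw [e]
  refine (norm_add_le _ _).trans ((add_le_add h1 h2).trans_eq ?_)
  ring

/-- The truncated equation has global solutions. -/
theorem exists_truncated_solution (hw : IsSubmultWeight w) (Λ : ι → ℝ) {R T : ℝ} (hR : 0 < R)
    (hT : 0 ≤ T) (a₀ : SummableSeq ι) :
    ∃ u : ℝ → SummableSeq ι, u 0 = a₀ ∧ ∀ t ∈ Set.Icc 0 T,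
      HasDerivWithinAt u (cutoff R (u t) • nlsField w Λ t (u t)) (Set.Icc 0 T) t := by
  set L : NNReal := ⟨(2 * R) ^ 3, by positivity⟩ with hL
  -- The truncated field has norm at most L everywhere, so a trajectory cannot leave this ball
  -- before time T, and a single Picard–Lindelöf step covers the whole interval.
  set ρ : NNReal := L * ⟨T, hT⟩ with hρ
  set B : ℝ := ‖a₀‖ + ρ with hBdef
  have hB : 0 ≤ B := by positivity
  set K : NNReal := ⟨B ^ 3 / R + 3 * B ^ 2, by positivity⟩ with hK
  have hball : ∀ a ∈ Metric.closedBall a₀ (ρ : ℝ), ‖a‖ ≤ B := fun a ha => by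
    have h1 : ‖a - a₀‖ ≤ ρ := by simpa [dist_eq_norm] using ha
    have h2 := norm_le_norm_add_norm_sub' a a₀
    linarith
  have hPL : IsPicardLindelof (fun t a => cutoff R a • nlsField w Λ t a)
      (tmin := 0) (tmax := T) ⟨0, le_rfl, hT⟩ a₀ ρ 0 L K := by
    refine ⟨fun t _ => LipschitzOnWith.of_dist_le_mul fun a ha b hb => ?_, fun a _ => ?_,
      fun t _ a _ => norm_cutoff_smul_nlsField_le hw Λ hR t a, ?_⟩
    · rw [dist_eq_norm, dist_eq_norm]
      exact norm_cutoff_smul_nlsField_sub_le hw Λ hR t (hball a ha) (hball b hb)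
    · exact ((continuous_nlsField hw Λ a).const_smul (cutoff R a)).continuousOn
    · simp only [sub_zero, sub_self, max_eq_left hT, NNReal.coe_zero]
      exact le_rfl
  obtain ⟨u, hu0, hu⟩ := hPL.exists_eq_forall_mem_Icc_hasDerivWithinAt₀
  exact ⟨u, hu0, hu⟩

end Truncation

/-- A real scalar factor χ keeps the field orthogonal to the solution in the real inner product of
L², so mass is conserved by the truncated equation as well. -/
theorem norm_fourierSeriesL2_eq {w : (Fin 2 → ℤ) → ℝ} (hw : IsSubmultWeight w)
    (Λ : (Fin 2 → ℤ) → ℝ) {T : ℝ} {u : ℝ → SummableSeq (Fin 2 → ℤ)} {χ : ℝ → ℝ}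
    (hu : ∀ t ∈ Set.Icc 0 T, HasDerivWithinAt u (χ t • nlsField w Λ t (u t)) (Set.Icc 0 T) t)
    {t : ℝ} (ht : t ∈ Set.Icc 0 T) :
    ‖fourierSeriesL2 hw (u t)‖ = ‖fourierSeriesL2 hw (u 0)‖ := by
  set L := (fourierSeriesL2 hw).restrictScalars ℝ
  have hL : ∀ t ∈ Set.Icc 0 T, HasDerivWithinAt (fun t => L (u t))
      (χ t • L (nlsField w Λ t (u t))) (Set.Icc 0 T) t := fun t ht => by
    rw [← map_smul]
    exact L.hasFDerivAt.comp_hasDerivWithinAt t (hu t ht)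
  have hd : ∀ t ∈ Set.Icc 0 T, HasDerivWithinAt (fun t => inner ℂ (L (u t)) (L (u t))) 0
      (Set.Icc 0 T) t := fun t ht => by
    refine ((hL t ht).inner ℂ (hL t ht)).congr_deriv ?_
    have h0 : (inner ℂ (L (u t)) (L (nlsField w Λ t (u t)))).re = 0 :=
      re_inner_nlsField hw Λ t (u t)
    have h1 : χ t • L (nlsField w Λ t (u t)) = (χ t : ℂ) • L (nlsField w Λ t (u t)) :=
      (Complex.coe_smul _ _).symm
    rw [h1, inner_smul_right, inner_smul_left, Complex.conj_ofReal,
      ← inner_conj_symm (L (nlsField w Λ t (u t))), ← mul_add, Complex.add_conj, h0]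
    simp
  have hc := constant_of_has_deriv_right_zero (fun t ht => (hd t ht).continuousWithinAt)
    (fun t ht => (hd t (Set.Ico_subset_Icc_self ht)).Ici_of_Icc ht) t ht
  have h2 := congrArg Complex.re hc
  have e : ∀ f : L2Torus, (inner ℂ f f).re = ‖f‖ ^ 2 := fun f => inner_self_eq_norm_sq (𝕜 := ℂ) f
  rw [e, e] at h2
  exact (sq_eq_sq₀ (norm_nonneg _) (norm_nonneg _)).1 h2

/-! ### The part of the solution outside a finite set of frequencies -/

section Outer

open SummableSeq

variable {ι : Type*} [DecidableEq ι]

/-- The projection that removes the frequencies of `Q`. -/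
def removeFreq (Q : Finset ι) : SummableSeq ι →L[ℂ] SummableSeq ι :=
  LinearMap.mkContinuous
    { toFun := fun a => mk (fun k => if k ∈ Q then 0 else a k)
        (Summable.of_nonneg_of_le (fun _ => norm_nonneg _)
          (fun k => by split_ifs <;> simp) a.summable_norm)
      map_add' := fun a b => by
        ext k
        by_cases hk : k ∈ Q <;> simp [hk]
      map_smul' := fun c a => by
        ext k
        by_cases hk : k ∈ Q <;> simp [hk] }
    1 fun a => by
      rw [one_mul, norm_eq_tsum, norm_eq_tsum]
      exact Summable.tsum_le_tsum (fun k => by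
        change ‖if k ∈ Q then (0 : ℂ) else a k‖ ≤ ‖a k‖
        split_ifs <;> simp) (summable_norm _) a.summable_norm

theorem removeFreq_apply (Q : Finset ι) (a : SummableSeq ι) (k : ι) :
    removeFreq Q a k = if k ∈ Q then 0 else a k := rfl

theorem norm_removeFreq_le (Q : Finset ι) (a : SummableSeq ι) : ‖removeFreq Q a‖ ≤ ‖a‖ := by
  have h := (removeFreq Q).le_of_opNorm_le (LinearMap.mkContinuous_norm_le _ zero_le_one _) a
  rwa [one_mul] at h

theorem removeFreq_single (Q : Finset ι) (k : ι) (z : ℂ) :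
    removeFreq Q (lp.single 1 k z) = if k ∈ Q then 0 else lp.single 1 k z := by
  ext j
  rw [removeFreq_apply]
  by_cases hj : j = k
  · subst hj
    split_ifs <;> simp
  · have h0 := lp.single_apply_ne (E := fun _ : ι => ℂ) 1 k z hj
    rw [h0]
    split_ifs <;> first | rfl | exact h0.symm

theorem sub_removeFreq_apply (Q : Finset ι) (a : SummableSeq ι) (k : ι) :
    (a - removeFreq Q a) k = if k ∈ Q then a k else 0 := by
  rw [lp.coeFn_sub, Pi.sub_apply, removeFreq_apply]
  split_ifs <;> simp

theorem norm_sub_removeFreq (Q : Finset ι) (a : SummableSeq ι) :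
    ‖a - removeFreq Q a‖ = ∑ k ∈ Q, ‖a k‖ := by
  rw [norm_eq_tsum, tsum_eq_sum (s := Q) fun k hk => by rw [sub_removeFreq_apply]; simp [hk]]
  exact Finset.sum_congr rfl fun k hk => by rw [sub_removeFreq_apply, if_pos hk]

variable [AddCommGroup ι]

/-- The interactions of frequencies of `Q` that produce a frequency outside `Q`. -/
def outgoing (Q : Finset ι) : Finset (ι × ι × ι) :=
  (Q ×ˢ Q ×ˢ Q).filter fun x => outFreq x ∉ Q

/-- Isolates the forcing of the outer frequencies by the inner ones: a finite sum, to which the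
normal form applies. -/
theorem removeFreq_nlsField (w Λ : ι → ℝ) (t : ℝ) (Q : Finset ι) (a : SummableSeq ι) :
    removeFreq Q (nlsField w Λ t (a - removeFreq Q a)) =
      ∑ x ∈ outgoing Q, lp.single 1 (outFreq x)
        (nlsKernel w Λ t x * (a x.1 * conj (a x.2.1) * a x.2.2)) := by
  rw [nlsField, cubicSum, tsum_eq_sum (s := Q ×ˢ Q ×ˢ Q), map_sum, outgoing, Finset.sum_filter]
  · refine Finset.sum_congr rfl fun x hx => ?_
    simp only [Finset.mem_product] at hx
    rw [cubicTerm, removeFreq_single, sub_removeFreq_apply, sub_removeFreq_apply,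
      sub_removeFreq_apply, if_pos hx.1, if_pos hx.2.1, if_pos hx.2.2, ite_not]
  · intro x hx
    have : (a - removeFreq Q a) x.1 * conj ((a - removeFreq Q a) x.2.1) *
        (a - removeFreq Q a) x.2.2 = 0 := by
      rw [sub_removeFreq_apply, sub_removeFreq_apply, sub_removeFreq_apply]
      simp only [Finset.mem_product, not_and_or] at hx
      rcases hx with h | h | h <;> simp [h]
    rw [cubicTerm, this, mul_zero, lp.single_zero]

/-- The sum of the inverse phases of the outgoing interactions. -/
def inversePhaseSum (Λ : ι → ℝ) (Q : Finset ι) : ℝ := ∑ x ∈ outgoing Q, |phase Λ x|⁻¹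

theorem inversePhaseSum_nonneg (Λ : ι → ℝ) (Q : Finset ι) : 0 ≤ inversePhaseSum Λ Q :=
  Finset.sum_nonneg fun _ _ => by positivity

/-- The normal form correction: an approximate time primitive of the outgoing interactions. -/
def normalForm (w Λ : ι → ℝ) (Q : Finset ι) (t : ℝ) (z : ι × ι × ι → ℂ) : SummableSeq ι :=
  ∑ x ∈ outgoing Q, lp.single 1 (outFreq x)
    (nlsKernel w Λ t x * (Complex.I * phase Λ x)⁻¹ * z x)

theorem norm_normalForm_le {w : ι → ℝ} (hw : IsSubmultWeight w) (Λ : ι → ℝ) (Q : Finset ι)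
    (t : ℝ) {z : ι × ι × ι → ℂ} {B : ℝ} (hz : ∀ x, ‖z x‖ ≤ B) :
    ‖normalForm w Λ Q t z‖ ≤ inversePhaseSum Λ Q * B := by
  rw [normalForm, inversePhaseSum, Finset.sum_mul]
  refine norm_sum_le_of_le _ fun x _ => ?_
  rw [lp.norm_single (by simp), norm_mul, norm_mul, norm_inv, norm_mul, Complex.norm_I, one_mul,
    Complex.norm_real, Real.norm_eq_abs]
  refine mul_le_mul ?_ (hz x) (norm_nonneg _) (by positivity)
  exact mul_le_of_le_one_left (by positivity) (norm_nlsKernel_le hw Λ t x)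

/-- Integration by parts in time: dividing the kernel by i·phase gives a primitive of it, and the
error is the same expression with `z` differentiated. -/
theorem hasDerivWithinAt_normalForm (w Λ : ι → ℝ) {Q : Finset ι}
    (hres : ∀ x ∈ outgoing Q, phase Λ x ≠ 0) {z : ℝ → ι × ι × ι → ℂ} {z' : ι × ι × ι → ℂ}
    {s : Set ℝ} {t : ℝ} (hz : ∀ x, HasDerivWithinAt (fun t => z t x) (z' x) s t) :
    HasDerivWithinAt (fun t => normalForm w Λ Q t (z t))
      (∑ x ∈ outgoing Q, lp.single 1 (outFreq x) (nlsKernel w Λ t x * z t x) +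
        normalForm w Λ Q t z') s t := by
  rw [normalForm, ← Finset.sum_add_distrib]
  refine HasDerivWithinAt.fun_sum fun x hx => ?_
  have h := (((hasDerivAt_nlsKernel w Λ t x).hasDerivWithinAt (s := s)).mul_const
    (Complex.I * (phase Λ x : ℂ))⁻¹).mul (hz x)
  have h2 := (lp.singleContinuousLinearMap ℝ (fun _ : ι => ℂ) 1
    (outFreq x)).hasFDerivAt.comp_hasDerivWithinAt t h
  refine h2.congr_deriv ?_
  rw [lp.singleContinuousLinearMap_apply, ← lp.single_add, mul_assoc (nlsKernel w Λ t x),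
    mul_inv_cancel₀ (mul_ne_zero Complex.I_ne_zero (Complex.ofReal_ne_zero.2 (hres x hx))), mul_one]

theorem norm_mul_conj_mul_le {a b c : ℂ} {A B C : ℝ} (ha : ‖a‖ ≤ A) (hb : ‖b‖ ≤ B) (hc : ‖c‖ ≤ C) :
    ‖a * conj b * c‖ ≤ A * B * C := by
  have hA := (norm_nonneg a).trans ha
  have hB := (norm_nonneg b).trans hb
  rw [norm_mul, norm_mul, RCLike.norm_conj]
  gcongr

/-- Gronwall for the outer part minus its normal form. After the subtraction the forcing is of order
R⁵, so times of order R⁻² cost only a constant factor. -/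
theorem norm_removeFreq_solution_le {w : ι → ℝ} (hw : IsSubmultWeight w) (Λ : ι → ℝ)
    {Q : Finset ι} (hres : ∀ x ∈ outgoing Q, phase Λ x ≠ 0) {R T : ℝ} (hR : 0 < R)
    {u : ℝ → SummableSeq ι}
    (hu : ∀ t ∈ Set.Icc 0 T, HasDerivWithinAt u (nlsField w Λ t (u t)) (Set.Icc 0 T) t)
    (huR : ∀ t ∈ Set.Icc 0 T, ‖u t‖ ≤ R) (hu0 : removeFreq Q (u 0) = 0)
    {t : ℝ} (ht : t ∈ Set.Icc 0 T) :
    ‖removeFreq Q (u t)‖ ≤ 4 * inversePhaseSum Λ Q * R ^ 3 * Real.exp (3 * R ^ 2 * t) := by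
  have hT : 0 ≤ T := ht.1.trans ht.2
  set S := inversePhaseSum Λ Q
  have hS : 0 ≤ S := inversePhaseSum_nonneg Λ Q
  set z : ℝ → ι × ι × ι → ℂ := fun t x => u t x.1 * conj (u t x.2.1) * u t x.2.2
  set v : ℝ → SummableSeq ι := fun t => nlsField w Λ t (u t)
  set z' : ℝ → ι × ι × ι → ℂ := fun t x =>
    (v t x.1 * conj (u t x.2.1) + u t x.1 * conj (v t x.2.1)) * u t x.2.2 +
      u t x.1 * conj (u t x.2.1) * v t x.2.2
  have hcoord : ∀ t ∈ Set.Icc 0 T, ∀ k, HasDerivWithinAt (fun t => u t k) (v t k)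
      (Set.Icc 0 T) t := fun t ht k =>
    (lp.evalCLM ℝ (fun _ : ι => ℂ) 1 k).hasFDerivAt.comp_hasDerivWithinAt t (hu t ht)
  have hz : ∀ t ∈ Set.Icc 0 T, ∀ x, HasDerivWithinAt (fun t => z t x) (z' t x)
      (Set.Icc 0 T) t := fun t ht x =>
    ((hcoord t ht x.1).mul (hcoord t ht x.2.1).star).mul (hcoord t ht x.2.2)
  have hun : ∀ t ∈ Set.Icc 0 T, ∀ k, ‖u t k‖ ≤ R := fun t ht k =>
    (norm_apply_le _ _).trans (huR t ht)
  have hvn : ∀ t ∈ Set.Icc 0 T, ∀ k, ‖v t k‖ ≤ R ^ 3 := fun t ht k =>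
    (norm_apply_le _ _).trans (norm_nlsField_le hw Λ t (huR t ht))
  have hzn : ∀ t ∈ Set.Icc 0 T, ∀ x, ‖z t x‖ ≤ R ^ 3 := fun t ht x =>
    (norm_mul_conj_mul_le (hun t ht _) (hun t ht _) (hun t ht _)).trans_eq (by ring)
  have hzn' : ∀ t ∈ Set.Icc 0 T, ∀ x, ‖z' t x‖ ≤ 3 * R ^ 5 := fun t ht x => by
    have h1 := norm_mul_conj_mul_le (hvn t ht x.1) (hun t ht x.2.1) (hun t ht x.2.2)
    have h2 := norm_mul_conj_mul_le (hun t ht x.1) (hvn t ht x.2.1) (hun t ht x.2.2)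
    have h3 := norm_mul_conj_mul_le (hun t ht x.1) (hun t ht x.2.1) (hvn t ht x.2.2)
    simp only [z', add_mul]
    refine norm_add₃_le.trans ?_
    linarith
  set H : ℝ → SummableSeq ι := fun t => normalForm w Λ Q t (z t)
  have hHn : ∀ t ∈ Set.Icc 0 T, ‖H t‖ ≤ S * R ^ 3 := fun t ht =>
    norm_normalForm_le hw Λ Q t (hzn t ht)
  set g : ℝ → SummableSeq ι := fun t => removeFreq Q (u t) - H t
  set g' : ℝ → SummableSeq ι := fun t =>
    removeFreq Q (v t - nlsField w Λ t (u t - removeFreq Q (u t))) - normalForm w Λ Q t (z' t)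
  have hg : ∀ t ∈ Set.Icc 0 T, HasDerivWithinAt g (g' t) (Set.Icc 0 T) t := fun t ht => by
    have h1 : HasDerivWithinAt (fun t => removeFreq Q (u t)) (removeFreq Q (v t))
        (Set.Icc 0 T) t :=
      ((removeFreq Q).restrictScalars ℝ).hasFDerivAt.comp_hasDerivWithinAt t (hu t ht)
    refine (h1.sub (hasDerivWithinAt_normalForm w Λ hres (hz t ht))).congr_deriv ?_
    simp only [g', map_sub, removeFreq_nlsField, z]
    abel
  have hqg : ∀ t ∈ Set.Icc 0 T, ‖removeFreq Q (u t)‖ ≤ ‖g t‖ + S * R ^ 3 := fun t ht => by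
    have h1 : removeFreq Q (u t) = g t + H t := by simp [g]
    rw [h1]
    exact (norm_add_le _ _).trans (add_le_add le_rfl (hHn t ht))
  have hpn : ∀ t ∈ Set.Icc 0 T, ‖u t - removeFreq Q (u t)‖ ≤ R := fun t ht => by
    refine le_trans ?_ (huR t ht)
    rw [norm_sub_removeFreq, norm_eq_tsum]
    exact (u t).summable_norm.sum_le_tsum Q fun _ _ => norm_nonneg _
  -- Half of the 6 comes from replacing the outer part by `g` plus the correction in the Lipschitz
  -- bound, half from the three factors differentiated in `z'`.
  have hbound : ∀ t ∈ Set.Icc 0 T, ‖g' t‖ ≤ 3 * R ^ 2 * ‖g t‖ + 6 * S * R ^ 5 := fun t ht => by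
    have h1 : ‖removeFreq Q (v t - nlsField w Λ t (u t - removeFreq Q (u t)))‖ ≤
        3 * R ^ 2 * ‖removeFreq Q (u t)‖ := by
      refine (norm_removeFreq_le _ _).trans ?_
      have := norm_nlsField_sub_le hw Λ t (huR t ht) (hpn t ht)
      rwa [sub_sub_cancel] at this
    have h2 := norm_normalForm_le hw Λ Q t (hzn' t ht)
    have h3 : 3 * R ^ 2 * ‖removeFreq Q (u t)‖ ≤ 3 * R ^ 2 * (‖g t‖ + S * R ^ 3) :=
      mul_le_mul_of_nonneg_left (hqg t ht) (by positivity)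
    refine (norm_sub_le _ _).trans ?_
    nlinarith
  have h0 : ‖g 0‖ ≤ S * R ^ 3 := by
    simp only [g, hu0, zero_sub, norm_neg]
    exact hHn 0 ⟨le_rfl, hT⟩
  have hG := norm_le_gronwallBound_of_norm_deriv_right_le
    (fun t ht => (hg t ht).continuousWithinAt)
    (fun t ht => (hg t (Set.Ico_subset_Icc_self ht)).Ici_of_Icc ht) h0
    (fun t ht => hbound t (Set.Ico_subset_Icc_self ht)) t ht
  have hK : 3 * R ^ 2 ≠ 0 := by positivity
  rw [gronwallBound_of_K_ne_0 hK, sub_zero] at hG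
  have e : 6 * S * R ^ 5 / (3 * R ^ 2) = 2 * (S * R ^ 3) := by
    field_simp
    ring
  rw [e] at hG
  have hexp : 1 ≤ Real.exp (3 * R ^ 2 * t) := Real.one_le_exp (mul_nonneg (by positivity) ht.1)
  have hSR : 0 ≤ S * R ^ 3 := by positivity
  have := hqg t ht
  -- With E the exponential, the bounds add up to SR³E + 2SR³(E - 1) + SR³, which is below 4SR³E.
  nlinarith

end Outer

/-! ### Long time existence in the interaction picture -/

/-- At the first time when g reaches B, the bound holds on the whole past, so the strict improvement
gives a contradiction. -/
theorem le_of_bootstrap {g : ℝ → ℝ} {T B : ℝ} (hg : ContinuousOn g (Set.Icc 0 T))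
    (h0 : g 0 ≤ B) (h : ∀ t ∈ Set.Icc 0 T, (∀ τ ∈ Set.Icc 0 t, g τ ≤ B) → g t < B) :
    ∀ t ∈ Set.Icc 0 T, g t ≤ B := by
  intro t ht
  have hT : 0 ≤ T := ht.1.trans ht.2
  by_contra! hlt
  set s := {τ ∈ Set.Icc 0 T | B ≤ g τ} with hs
  have hsc : IsClosed s := by
    have := hg.preimage_isClosed_of_isClosed isClosed_Icc (isClosed_Ici (a := B))
    exact this
  have hne : s.Nonempty := ⟨t, ht, hlt.le⟩
  have hbdd : BddBelow s := ⟨0, fun τ hτ => hτ.1.1⟩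
  have hmem := hsc.csInf_mem hne hbdd
  refine absurd (h _ hmem.1 fun τ hτ => ?_) (not_lt.2 hmem.2)
  rcases hτ.2.lt_or_eq with hlt' | heq
  · by_contra! hcon
    exact absurd (csInf_le hbdd ⟨⟨hτ.1, hτ.2.trans hmem.1.2⟩, hcon.le⟩) (not_le.2 hlt')
  -- At the first time itself g cannot exceed B: by the intermediate value theorem the value B would
  -- be attained no later, hence at that same time.
  · rw [heq]
    by_contra! hcon
    have hpos : 0 < sInf s := by
      rcases hmem.1.1.lt_or_eq with h1 | h1
      · exact h1
      · rw [← h1] at hcon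
        exact absurd h0 (not_le.2 hcon)
    have hIVT := intermediate_value_Icc hmem.1.1
      (hg.mono (Set.Icc_subset_Icc_right hmem.1.2))
    obtain ⟨σ, hσ, hσe⟩ := hIVT ⟨h0, hcon.le⟩
    have h2 := csInf_le hbdd (⟨⟨hσ.1, hσ.2.trans hmem.1.2⟩, hσe.ge⟩ : σ ∈ s)
    rw [le_antisymm hσ.2 h2] at hσe
    exact absurd hσe hcon.ne'

theorem exists_long_time_solution {w : (Fin 2 → ℤ) → ℝ} (hw : IsSubmultWeight w)
    (Λ : (Fin 2 → ℤ) → ℝ) (Q : Finset (Fin 2 → ℤ)) (hres : ∀ x ∈ outgoing Q, phase Λ x ≠ 0) :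
    ∃ C : ℝ, 0 ≤ C ∧ ∀ ε : ℝ, 0 < ε → C * ε ^ 2 < 1 → ∀ a₀ : SummableSeq (Fin 2 → ℤ),
      removeFreq Q a₀ = 0 → ‖fourierSeriesL2 hw a₀‖ ≤ ε →
      ∃ u : ℝ → SummableSeq (Fin 2 → ℤ), u 0 = a₀ ∧
        (∀ t ∈ Set.Icc 0 (1 / ε ^ 2),
          HasDerivWithinAt u (nlsField w Λ t (u t)) (Set.Icc 0 (1 / ε ^ 2)) t) ∧
        ∀ t ∈ Set.Icc 0 (1 / ε ^ 2), ‖removeFreq Q (u t)‖ ≤ C * ε ^ 3 := by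
  -- The sum bounds the part on Q through the mass; the extra 1 accommodates the bootstrap
  -- hypothesis that the outer part is at most ε.
  set A : ℝ := ∑ k ∈ Q, w k + 1 with hA
  have hApos : 0 < A := by
    have : 0 ≤ ∑ k ∈ Q, w k := Finset.sum_nonneg fun k _ => (hw.pos k).le
    positivity
  have hS := inversePhaseSum_nonneg Λ Q
  refine ⟨4 * inversePhaseSum Λ Q * A ^ 3 * Real.exp (3 * A ^ 2), by positivity, ?_⟩
  set C := 4 * inversePhaseSum Λ Q * A ^ 3 * Real.exp (3 * A ^ 2) with hC
  intro ε hε hεC a₀ ha₀ hmass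
  set T : ℝ := 1 / ε ^ 2 with hT
  have hTpos : 0 < T := by positivity
  set R : ℝ := A * ε with hR
  have hRpos : 0 < R := by positivity
  obtain ⟨u, hu0, hu⟩ := exists_truncated_solution hw Λ hRpos hTpos.le a₀
  have hcoef : ∀ t ∈ Set.Icc 0 T, ∀ k, ‖u t k‖ ≤ w k * ε := fun t ht k => by
    have h1 := norm_mFourierCoeff_le (fourierSeriesL2 hw (u t)) k
    rw [mFourierCoeff_fourierSeriesL2, norm_fourierSeriesL2_eq hw Λ hu ht, hu0, norm_mul,
      norm_inv, Complex.norm_real, Real.norm_of_nonneg (hw.pos k).le, ← div_eq_mul_inv,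
      div_le_iff₀ (hw.pos k)] at h1
    nlinarith [hw.pos k]
  have hinner : ∀ t ∈ Set.Icc 0 T, ‖u t - removeFreq Q (u t)‖ ≤ (∑ k ∈ Q, w k) * ε :=
    fun t ht => by
      rw [norm_sub_removeFreq, Finset.sum_mul]
      exact Finset.sum_le_sum fun k _ => hcoef t ht k
  have htotal : ∀ t ∈ Set.Icc 0 T, ‖removeFreq Q (u t)‖ ≤ ε → ‖u t‖ ≤ R := fun t ht h => by
    have h1 := hinner t ht
    have h2 := norm_le_norm_add_norm_sub' (u t) (removeFreq Q (u t))
    rw [hR, hA]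
    linarith
  have hsol : ∀ t ∈ Set.Icc 0 T, (∀ τ ∈ Set.Icc 0 t, ‖removeFreq Q (u τ)‖ ≤ ε) →
      ∀ τ ∈ Set.Icc 0 t, HasDerivWithinAt u (nlsField w Λ τ (u τ)) (Set.Icc 0 t) τ :=
    fun t ht h τ hτ => by
      have hτT : τ ∈ Set.Icc 0 T := ⟨hτ.1, hτ.2.trans ht.2⟩
      have h1 := (hu τ hτT).mono (Set.Icc_subset_Icc_right ht.2)
      rwa [cutoff_eq_one hRpos (htotal τ hτT (h τ hτ)), one_smul] at h1
  have hest : ∀ t ∈ Set.Icc 0 T, (∀ τ ∈ Set.Icc 0 t, ‖removeFreq Q (u τ)‖ ≤ ε) →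
      ‖removeFreq Q (u t)‖ ≤ C * ε ^ 3 := fun t ht h => by
    refine (norm_removeFreq_solution_le hw Λ hres hRpos (hsol t ht h)
      (fun τ hτ => htotal τ ⟨hτ.1, hτ.2.trans ht.2⟩ (h τ hτ)) (by rw [hu0, ha₀])
      ⟨ht.1, le_rfl⟩).trans ?_
    -- The time scale 1/ε² is exactly the one on which the Gronwall exponent stays bounded
    -- independently of ε.
    have h1 : 3 * R ^ 2 * t ≤ 3 * A ^ 2 := by
      have h2 : 3 * R ^ 2 * t ≤ 3 * R ^ 2 * T := mul_le_mul_of_nonneg_left ht.2 (by positivity)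
      have h3 : 3 * R ^ 2 * T = 3 * A ^ 2 := by
        rw [hR, hT]
        field_simp
      linarith
    calc 4 * inversePhaseSum Λ Q * R ^ 3 * Real.exp (3 * R ^ 2 * t)
        ≤ 4 * inversePhaseSum Λ Q * R ^ 3 * Real.exp (3 * A ^ 2) := by gcongr
      _ = C * ε ^ 3 := by
        rw [hC, hR]
        ring
  have hCε : C * ε ^ 3 < ε := by
    calc C * ε ^ 3 = C * ε ^ 2 * ε := by ring
      _ < 1 * ε := mul_lt_mul_of_pos_right hεC hε
      _ = ε := one_mul ε
  have hcont : ContinuousOn (fun t => ‖removeFreq Q (u t)‖) (Set.Icc 0 T) := fun t ht =>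
    ((removeFreq Q).continuous.continuousAt.comp_continuousWithinAt
      (hu t ht).continuousWithinAt).norm
  have hall := le_of_bootstrap hcont (by simp [hu0, ha₀, hε.le])
    fun t ht h => (hest t ht h).trans_lt hCε
  refine ⟨u, hu0, hsol T ⟨hTpos.le, le_rfl⟩ hall, fun t ht => hest t ht fun τ hτ =>
    hall τ ⟨hτ.1, hτ.2.trans ht.2⟩⟩

/-! ### Uniqueness -/

section Uniqueness

open SummableSeq UnitAddTorus

/-- Coordinatewise derivatives assemble into an ℓ¹ derivative because the ℓ¹ integral of the
continuous function f has the same coordinate derivatives and initial value as u. -/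
theorem SummableSeq.hasDerivWithinAt_of_apply {ι : Type*} {u f : ℝ → SummableSeq ι} {T : ℝ}
    (hf : ContinuousOn f (Set.Icc 0 T))
    (hu : ∀ k, ∀ t ∈ Set.Icc 0 T, HasDerivWithinAt (fun t => u t k) (f t k) (Set.Icc 0 T) t)
    {t : ℝ} (ht : t ∈ Set.Icc 0 T) : HasDerivWithinAt u (f t) (Set.Icc 0 T) t := by
  have hT : 0 ≤ T := ht.1.trans ht.2
  set F : ℝ → SummableSeq ι := Set.IccExtend hT ((Set.Icc 0 T).domRestrict f) with hF
  have hFc : Continuous F := (continuousOn_iff_continuous_domRestrict.1 hf).Icc_extend'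
  have hFf : ∀ t ∈ Set.Icc 0 T, F t = f t := fun t ht => Set.IccExtend_of_mem hT _ ht
  set g : ℝ → SummableSeq ι := fun t => u 0 + ∫ τ in (0 : ℝ)..t, F τ with hgdef
  have hg : ∀ t, HasDerivAt g (F t) t := fun t =>
    (hFc.integral_hasStrictDerivAt 0 t).hasDerivAt.const_add (u 0)
  have hug : ∀ t ∈ Set.Icc 0 T, u t = g t := fun t ht => by
    ext k
    have hd : ∀ τ ∈ Set.Icc 0 T, HasDerivWithinAt (fun τ => u τ k - g τ k) 0 (Set.Icc 0 T) τ :=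
      fun τ hτ => by
        have h1 : HasDerivAt (fun τ => g τ k) (F τ k) τ :=
          (lp.evalCLM ℝ (fun _ : ι => ℂ) 1 k).hasFDerivAt.comp_hasDerivAt τ (hg τ)
        refine ((hu k τ hτ).sub h1.hasDerivWithinAt).congr_deriv ?_
        rw [hFf τ hτ, sub_self]
    have hc := constant_of_has_deriv_right_zero (fun τ hτ => (hd τ hτ).continuousWithinAt)
      (fun τ hτ => (hd τ (Set.Ico_subset_Icc_self hτ)).Ici_of_Icc hτ) t ht
    simpa [hgdef, sub_eq_zero] using hc
  rw [← hFf t ht]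
  exact (hg t).hasDerivWithinAt.congr hug (hug t ht)

theorem continuousOn_nlsField {ι : Type*} [AddCommGroup ι] [DecidableEq ι] {w : ι → ℝ}
    (hw : IsSubmultWeight w) (Λ : ι → ℝ) {u : ℝ → SummableSeq ι} {T : ℝ}
    (hu : ContinuousOn u (Set.Icc 0 T)) :
    ContinuousOn (fun t => nlsField w Λ t (u t)) (Set.Icc 0 T) := by
  obtain ⟨R, hR⟩ := isCompact_Icc.exists_bound_of_continuousOn hu
  intro t₀ ht₀
  have h1 := (tendsto_iff_norm_sub_tendsto_zero.1 (hu t₀ ht₀)).const_mul (3 * R ^ 2)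
  have h2 := tendsto_iff_norm_sub_tendsto_zero.1
    ((continuous_nlsField hw Λ (u t₀)).continuousWithinAt (s := Set.Icc 0 T) (x := t₀))
  refine tendsto_iff_norm_sub_tendsto_zero.2 (squeeze_zero' (Eventually.of_forall fun _ =>
    norm_nonneg _) ?_ (by simpa using h1.add h2))
  filter_upwards [self_mem_nhdsWithin] with t ht
  exact (norm_sub_le_norm_sub_add_norm_sub _ (nlsField w Λ t (u t₀)) _).trans
    (add_le_add (norm_nlsField_sub_le hw Λ t (hR t ht) (hR t₀ ht₀)) le_rfl)

theorem eqOn_of_nlsField {ι : Type*} [AddCommGroup ι] [DecidableEq ι] {w : ι → ℝ}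
    (hw : IsSubmultWeight w) (Λ : ι → ℝ) {u v : ℝ → SummableSeq ι} {T : ℝ}
    (hu : ∀ t ∈ Set.Icc 0 T, HasDerivWithinAt u (nlsField w Λ t (u t)) (Set.Icc 0 T) t)
    (hv : ∀ t ∈ Set.Icc 0 T, HasDerivWithinAt v (nlsField w Λ t (v t)) (Set.Icc 0 T) t)
    (h0 : u 0 = v 0) : Set.EqOn u v (Set.Icc 0 T) := by
  have huc : ContinuousOn u (Set.Icc 0 T) := fun t ht => (hu t ht).continuousWithinAt
  have hvc : ContinuousOn v (Set.Icc 0 T) := fun t ht => (hv t ht).continuousWithinAt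
  obtain ⟨R₁, hR₁⟩ := isCompact_Icc.exists_bound_of_continuousOn huc
  obtain ⟨R₂, hR₂⟩ := isCompact_Icc.exists_bound_of_continuousOn hvc
  set R := max R₁ R₂
  refine ODE_solution_unique_of_mem_Icc_right (v := nlsField w Λ)
    (s := fun _ => Metric.closedBall 0 R) (K := ⟨3 * R ^ 2, by positivity⟩)
    (fun t _ => LipschitzOnWith.of_dist_le_mul fun a ha b hb => ?_) huc
    (fun t ht => (hu t (Set.Ico_subset_Icc_self ht)).Ici_of_Icc ht)
    (fun t ht => ?_) hvc (fun t ht => (hv t (Set.Ico_subset_Icc_self ht)).Ici_of_Icc ht)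
    (fun t ht => ?_) h0
  · rw [dist_eq_norm, dist_eq_norm]
    exact norm_nlsField_sub_le hw Λ t (mem_closedBall_zero_iff.1 ha) (mem_closedBall_zero_iff.1 hb)
  · exact mem_closedBall_zero_iff.2 ((hR₁ t (Set.Ico_subset_Icc_self ht)).trans (le_max_left _ _))
  · exact mem_closedBall_zero_iff.2 ((hR₂ t (Set.Ico_subset_Icc_self ht)).trans (le_max_right _ _))

/-! ### Sobolev weights and absolute summability of Fourier coefficients -/

theorem one_le_sobolevWeight {s : ℝ} (hs : 0 ≤ s) (k : Fin 2 → ℤ) : 1 ≤ sobolevWeight s k := by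
  have h : 0 ≤ ∑ i, (k i : ℝ) ^ 2 := Finset.sum_nonneg fun i _ => sq_nonneg _
  exact Real.one_le_rpow (by linarith) hs

/-- Comparison with the lattice sum of ‖k‖^(-2s), which converges in dimension two because 2s > 2.
-/
theorem summable_inv_sobolevWeight {s : ℝ} (hs : 1 < s) :
    Summable fun k : Fin 2 → ℤ => (sobolevWeight s k)⁻¹ := by
  have h := EisensteinSeries.summable_one_div_norm_rpow (k := 2 * s) (by linarith)
  refine Summable.of_norm_bounded_eventually h ?_
  have h0 : ∀ᶠ k : Fin 2 → ℤ in cofinite, k ≠ 0 := by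
    simp
  filter_upwards [h0] with k hk
  have hk' : 0 < ‖k‖ := norm_pos_iff.2 hk
  have h1 : ‖k‖ ^ 2 ≤ 1 + ∑ i, (k i : ℝ) ^ 2 := by
    have hle : ‖k‖ ≤ Real.sqrt (∑ i, (k i : ℝ) ^ 2) := by
      refine (pi_norm_le_iff_of_nonneg (Real.sqrt_nonneg _)).2 fun i => ?_
      rw [Int.norm_eq_abs]
      exact Real.abs_le_sqrt (Finset.single_le_sum (f := fun i => (k i : ℝ) ^ 2)
        (fun j _ => sq_nonneg _) (Finset.mem_univ i))
    have h2 : 0 ≤ ∑ i, (k i : ℝ) ^ 2 := Finset.sum_nonneg fun i _ => sq_nonneg _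
    have h3 := pow_le_pow_left₀ hk'.le hle 2
    rw [Real.sq_sqrt h2] at h3
    linarith
  have hpos : 0 < sobolevWeight s k := zero_lt_one.trans_le (one_le_sobolevWeight (by linarith) k)
  rw [Real.norm_of_nonneg (by positivity), Real.rpow_neg hk'.le, Real.rpow_mul hk'.le,
    Real.rpow_two]
  exact inv_anti₀ (by positivity) (Real.rpow_le_rpow (by positivity) h1 (by linarith))

/-- The embedding `H^s ⊂ ℱℓ¹` for `s > 1`. -/
theorem summable_mFourierCoeff_and_tsum_le {s : ℝ} (hs : 1 < s) {f : L2Torus}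
    (hf : MemSobolev s f) :
    (Summable fun k => ‖mFourierCoeff f k‖) ∧
      ∑' k, ‖mFourierCoeff f k‖ ≤
        Real.sqrt (∑' k : Fin 2 → ℤ, (sobolevWeight s k)⁻¹) * sobolevNorm s f := by
  have hpos : ∀ k, 0 < sobolevWeight s k := fun k =>
    zero_lt_one.trans_le (one_le_sobolevWeight (by linarith) k)
  have e1 : ∀ k, Real.sqrt (sobolevWeight s k)⁻¹ ^ (2 : ℝ) = (sobolevWeight s k)⁻¹ := fun k => by
    rw [Real.rpow_two, Real.sq_sqrt (inv_nonneg.2 (hpos k).le)]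
  have e2 : ∀ k, (Real.sqrt (sobolevWeight s k) * ‖mFourierCoeff f k‖) ^ (2 : ℝ) =
      sobolevWeight s k * ‖mFourierCoeff f k‖ ^ 2 := fun k => by
    rw [Real.rpow_two, mul_pow, Real.sq_sqrt (hpos k).le]
  have e3 : ∀ k, Real.sqrt (sobolevWeight s k)⁻¹ *
      (Real.sqrt (sobolevWeight s k) * ‖mFourierCoeff f k‖) = ‖mFourierCoeff f k‖ := fun k => by
    rw [← mul_assoc, ← Real.sqrt_mul (inv_nonneg.2 (hpos k).le), inv_mul_cancel₀ (hpos k).ne',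
      Real.sqrt_one, one_mul]
  have s1 : Summable fun k => Real.sqrt (sobolevWeight s k)⁻¹ ^ (2 : ℝ) := by
    simpa only [e1] using summable_inv_sobolevWeight hs
  have s2 : Summable fun k =>
      (Real.sqrt (sobolevWeight s k) * ‖mFourierCoeff f k‖) ^ (2 : ℝ) := by
    simp only [e2]
    exact hf
  -- Cauchy–Schwarz after inserting the square root of the weight and its inverse.
  have h1 := Real.summable_mul_of_Lp_Lq_of_nonneg Real.HolderConjugate.two_two
    (fun _ => Real.sqrt_nonneg _) (fun _ => by positivity) s1 s2
  have h2 := Real.inner_le_Lp_mul_Lq_tsum_of_nonneg Real.HolderConjugate.two_two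
    (fun _ => Real.sqrt_nonneg _) (fun _ => by positivity) s1 s2
  simp only [e1, e2, e3, ← Real.sqrt_eq_rpow] at h1 h2
  exact ⟨h1, h2⟩

theorem MemSobolev.sub {s : ℝ} {f g : L2Torus} (hs : 0 ≤ s) (hf : MemSobolev s f)
    (hg : MemSobolev s g) : MemSobolev s (f - g) := by
  refine Summable.of_nonneg_of_le (fun k => ?_) (fun k => ?_)
    ((Summable.add hf hg).mul_left 2)
  · have := one_le_sobolevWeight hs k
    positivity
  · have hW := one_le_sobolevWeight hs k
    rw [mFourierCoeff_sub, ← mul_add, mul_left_comm]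
    refine mul_le_mul_of_nonneg_left ?_ (by linarith)
    have h1 := norm_sub_le (mFourierCoeff f k) (mFourierCoeff g k)
    have h2 := pow_le_pow_left₀ (norm_nonneg _) h1 2
    nlinarith [sq_nonneg (‖mFourierCoeff f k‖ - ‖mFourierCoeff g k‖)]

theorem isSubmultWeight_one {ι : Type*} [AddCommGroup ι] :
    IsSubmultWeight (fun _ : ι => (1 : ℝ)) :=
  ⟨fun _ => le_rfl, fun _ _ => by norm_num, fun _ => rfl⟩

/-- Every `H^s` solution, `s > 1`, solves the interaction picture equation in `ℓ¹`. -/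
theorem IsNLSSolution.exists_interaction {ω : Fin 2 → ℝ} {s T : ℝ} (hs : 1 < s)
    {ψ₀ : Torus2 → ℂ} {φ : ℝ → L2Torus} (hφ : IsNLSSolution ω s T ψ₀ φ) :
    ∃ u : ℝ → SummableSeq (Fin 2 → ℤ),
      (∀ t ∈ Set.Icc 0 T, HasDerivWithinAt u
        (nlsField (fun _ => 1) (laplaceEigenvalue ω) t (u t)) (Set.Icc 0 T) t) ∧
      ∀ t ∈ Set.Icc 0 T, φ t = fourierSeriesL2 isSubmultWeight_one
        (rotate (fun k => laplaceEigenvalue ω k * t) (u t)) := by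
  classical
  set Λ := laplaceEigenvalue ω
  have hmem := hφ.continuous.1
  have hsum := fun t ht => (summable_mFourierCoeff_and_tsum_le hs (hmem t ht)).1
  set v : ℝ → SummableSeq (Fin 2 → ℤ) := fun t =>
    if h : Summable fun k => ‖mFourierCoeff (φ t) k‖ then SummableSeq.mk (mFourierCoeff (φ t)) h
    else 0
  have hv : ∀ t ∈ Set.Icc 0 T, ∀ k, v t k = mFourierCoeff (φ t) k := fun t ht k => by
    simp only [v, dif_pos (hsum t ht), mk_apply]
  have hvc : ContinuousOn v (Set.Icc 0 T) := fun t₀ ht₀ => by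
    have h1 := (hφ.continuous.2 t₀ ht₀).const_mul
      (Real.sqrt (∑' k : Fin 2 → ℤ, (sobolevWeight s k)⁻¹))
    rw [mul_zero] at h1
    refine tendsto_iff_norm_sub_tendsto_zero.2 (squeeze_zero' (Eventually.of_forall fun _ =>
      norm_nonneg _) ?_ h1)
    filter_upwards [self_mem_nhdsWithin] with t ht
    refine le_trans (le_of_eq ?_) (summable_mFourierCoeff_and_tsum_le hs
      ((hmem t ht).sub (by linarith) (hmem t₀ ht₀))).2
    rw [norm_eq_tsum]
    refine tsum_congr fun k => ?_
    rw [mFourierCoeff_sub, lp.coeFn_sub, Pi.sub_apply, hv t ht, hv t₀ ht₀]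
  set u : ℝ → SummableSeq (Fin 2 → ℤ) := fun t => rotate (fun k => -Λ k * t) (v t)
  have huc : ContinuousOn u (Set.Icc 0 T) := fun t ht => continuousWithinAt_rotate _ (hvc t ht)
  have hrot : ∀ t, rotate (fun k => Λ k * t) (u t) = v t := fun t => by
    ext k
    rw [rotate_apply, rotate_apply, ← mul_assoc, ← Complex.exp_add]
    push_cast
    rw [show Complex.I * ((Λ k : ℂ) * t) + Complex.I * (-(Λ k : ℂ) * t) = 0 by ring,
      Complex.exp_zero, one_mul]
  have hφv : ∀ t ∈ Set.Icc 0 T, φ t = fourierSeriesL2 isSubmultWeight_one (v t) := fun t ht =>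
    ext_mFourierCoeff fun k => by
      rw [mFourierCoeff_fourierSeriesL2, hv t ht]
      simp
  refine ⟨u, fun t ht => hasDerivWithinAt_of_apply
    (continuousOn_nlsField isSubmultWeight_one Λ huc) (fun k t ht => ?_) ht,
    fun t ht => by rw [hrot, hφv t ht]⟩
  obtain ⟨d, hd, heq⟩ := hφ.equation k t ht
  have hN := mFourierCoeff_norm_sq_mul isSubmultWeight_one (v t)
    (f := φ t) (by rw [hφv t ht]; exact coeFn_fourierSeriesL2 _ _) k
  rw [hN, ← hv t ht] at heq
  have hF := rotate_nlsField isSubmultWeight_one Λ t (u t) k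
  rw [hrot] at hF
  have hexp : HasDerivAt (fun τ : ℝ => Complex.exp (Complex.I * ((-Λ k * τ : ℝ) : ℂ)))
      (Complex.exp (Complex.I * ((-Λ k * t : ℝ) : ℂ)) * (Complex.I * (-Λ k : ℝ))) t := by
    have := ((((hasDerivAt_id t).const_mul (-Λ k)).ofReal_comp).const_mul Complex.I).cexp
    simpa using this
  have hprod := hexp.hasDerivWithinAt.mul hd
  refine (hprod.congr (fun τ hτ => ?_) ?_).congr_deriv ?_
  · rw [rotate_apply, hv τ hτ]
    rfl
  · rw [rotate_apply, hv t ht]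
    rfl
  · have hinv : Complex.exp (Complex.I * ((-Λ k * t : ℝ) : ℂ)) *
        Complex.exp (Complex.I * (Λ k * t : ℝ)) = 1 := by
      rw [← Complex.exp_add]
      push_cast
      rw [show Complex.I * (-(Λ k : ℂ) * t) + Complex.I * ((Λ k : ℂ) * t) = 0 by ring,
        Complex.exp_zero]
    have hF2 : nlsField (fun _ => 1) Λ t (u t) k =
        Complex.exp (Complex.I * ((-Λ k * t : ℝ) : ℂ)) * (Complex.I * cubicSum
          (fun x => (weightRatio (fun _ => (1 : ℝ)) x : ℂ)) (v t) (v t) (v t) k) := by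
      rw [← hF, ← mul_assoc, hinv, one_mul]
    rw [hF2, ← hv t ht]
    have hd' : d = -Complex.I * (Complex.I * d) := by
      rw [neg_mul, ← mul_assoc, Complex.I_mul_I]
      ring
    rw [hd', heq]
    push_cast
    simp only [inv_one, mul_one]
    ring

theorem IsNLSSolution.unique {ω : Fin 2 → ℝ} {s T : ℝ} (hs : 1 < s) {ψ₀ : Torus2 → ℂ}
    {φ ψ : ℝ → L2Torus} (hφ : IsNLSSolution ω s T ψ₀ φ) (hψ : IsNLSSolution ω s T ψ₀ ψ) {t : ℝ}
    (ht : t ∈ Set.Icc 0 T) : φ t = ψ t := by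
  classical
  obtain ⟨u, hu, hφu⟩ := hφ.exists_interaction hs
  obtain ⟨v, hv, hψv⟩ := hψ.exists_interaction hs
  have h0 : (0 : ℝ) ∈ Set.Icc 0 T := ⟨le_rfl, ht.1.trans ht.2⟩
  have hinit : φ 0 = ψ 0 := Lp.ext (hφ.initial.trans hψ.initial.symm)
  have huv : u 0 = v 0 := by
    ext k
    have h1 := congrArg (fun f : L2Torus => mFourierCoeff f k)
      ((hφu 0 h0).symm.trans (hinit.trans (hψv 0 h0)))
    simpa [mFourierCoeff_fourierSeriesL2] using h1
  rw [hφu t ht, hψv t ht, eqOn_of_nlsField isSubmultWeight_one _ hu hv huv ht]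

end Uniqueness

/-! ### Existence in the Sobolev space -/

section Existence

open SummableSeq UnitAddTorus

/-- A submultiplicative weight that dominates the Sobolev weights of order `s ≤ n`. -/
def productWeight (n : ℕ) (k : Fin 2 → ℤ) : ℝ := ((1 + |(k 0 : ℝ)|) * (1 + |(k 1 : ℝ)|)) ^ n

theorem isSubmultWeight_productWeight (n : ℕ) : IsSubmultWeight (productWeight n) where
  one_le k := one_le_pow₀ (one_le_mul_of_one_le_of_one_le (by simp) (by simp))
  add_le j k := by
    rw [productWeight, productWeight, productWeight, ← mul_pow]
    have h : ∀ i, 1 + |((j + k) i : ℝ)| ≤ (1 + |(j i : ℝ)|) * (1 + |(k i : ℝ)|) := fun i => by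
      have h1 := abs_add_le (j i : ℝ) (k i : ℝ)
      have h2 := mul_nonneg (abs_nonneg (j i : ℝ)) (abs_nonneg (k i : ℝ))
      rw [Pi.add_apply, Int.cast_add]
      nlinarith
    refine pow_le_pow_left₀ (by positivity) ?_ n
    refine (mul_le_mul (h 0) (h 1) (by positivity) (by positivity)).trans_eq ?_
    ring
  neg_eq k := by simp [productWeight]

theorem sobolevWeight_le {s : ℝ} {n : ℕ} (hn : s ≤ n) (k : Fin 2 → ℤ) :
    sobolevWeight s k ≤ productWeight n k ^ 2 := by
  have h0 : 0 ≤ ∑ i, (k i : ℝ) ^ 2 := Finset.sum_nonneg fun i _ => sq_nonneg _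
  refine (Real.rpow_le_rpow_of_exponent_le (by linarith) hn).trans ?_
  rw [Real.rpow_natCast, productWeight, ← pow_mul, mul_comm n 2, pow_mul]
  refine pow_le_pow_left₀ (by linarith) ?_ n
  rw [Fin.sum_univ_two, ← sq_abs (k 0 : ℝ), ← sq_abs (k 1 : ℝ)]
  have h1 := abs_nonneg (k 0 : ℝ)
  have h2 := abs_nonneg (k 1 : ℝ)
  nlinarith [mul_nonneg h1 h2, mul_nonneg (mul_nonneg h1 h1) h2, mul_nonneg h1 (mul_nonneg h2 h2),
    mul_nonneg (mul_nonneg h1 h1) (mul_nonneg h2 h2)]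

theorem SmoothOnTorus.continuous {f : Torus2 → ℂ} (hf : SmoothOnTorus f) : Continuous f := by
  have hq : IsOpenQuotientMap fun x : Fin 2 → ℝ => fun i => (x i : UnitAddCircle) :=
    IsOpenQuotientMap.piMap fun _ => QuotientAddGroup.isOpenQuotientMap_mk
  exact hq.isQuotientMap.continuous_iff.2 (ContDiff.continuous hf)

variable {w : (Fin 2 → ℤ) → ℝ} {s : ℝ}

theorem sobolevWeight_mul_le (hw : IsSubmultWeight w) (hws : ∀ k, sobolevWeight s k ≤ w k ^ 2)
    (a : SummableSeq (Fin 2 → ℤ)) (k : Fin 2 → ℤ) :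
    sobolevWeight s k * ‖mFourierCoeff (fourierSeriesL2 hw a) k‖ ^ 2 ≤ ‖a‖ * ‖a k‖ := by
  have hne := (hw.pos k).ne'
  rw [mFourierCoeff_fourierSeriesL2, norm_mul, norm_inv, Complex.norm_real,
    Real.norm_of_nonneg (hw.pos k).le]
  calc sobolevWeight s k * (‖a k‖ * (w k)⁻¹) ^ 2 ≤ w k ^ 2 * (‖a k‖ * (w k)⁻¹) ^ 2 :=
        mul_le_mul_of_nonneg_right (hws k) (by positivity)
    _ = ‖a k‖ * ‖a k‖ := by field_simp
    _ ≤ ‖a‖ * ‖a k‖ := mul_le_mul_of_nonneg_right (norm_apply_le a k) (norm_nonneg _)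

theorem sobolevWeight_nonneg (s : ℝ) (k : Fin 2 → ℤ) : 0 ≤ sobolevWeight s k :=
  Real.rpow_nonneg (add_nonneg zero_le_one (Finset.sum_nonneg fun _ _ => sq_nonneg _)) s

theorem memSobolev_fourierSeriesL2 (hw : IsSubmultWeight w)
    (hws : ∀ k, sobolevWeight s k ≤ w k ^ 2) (a : SummableSeq (Fin 2 → ℤ)) :
    MemSobolev s (fourierSeriesL2 hw a) :=
  Summable.of_nonneg_of_le (fun k => mul_nonneg (sobolevWeight_nonneg s k) (sq_nonneg _))
    (sobolevWeight_mul_le hw hws a) (a.summable_norm.mul_left _)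

theorem sobolevNorm_fourierSeriesL2_le (hw : IsSubmultWeight w)
    (hws : ∀ k, sobolevWeight s k ≤ w k ^ 2) (a : SummableSeq (Fin 2 → ℤ)) :
    sobolevNorm s (fourierSeriesL2 hw a) ≤ ‖a‖ := by
  rw [sobolevNorm, Real.sqrt_le_left (norm_nonneg _), sq]
  refine (Summable.tsum_le_tsum (sobolevWeight_mul_le hw hws a)
    (memSobolev_fourierSeriesL2 hw hws a) (a.summable_norm.mul_left _)).trans_eq ?_
  rw [tsum_mul_left, ← norm_eq_tsum]

theorem isNLSSolution_fourierSeriesL2 {ω : Fin 2 → ℝ} {T : ℝ} (hw : IsSubmultWeight w)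
    (hws : ∀ k, sobolevWeight s k ≤ w k ^ 2) {ψ₀ : Torus2 → ℂ}
    {u : ℝ → SummableSeq (Fin 2 → ℤ)}
    (hu : ∀ t ∈ Set.Icc 0 T, HasDerivWithinAt u
      (nlsField w (laplaceEigenvalue ω) t (u t)) (Set.Icc 0 T) t)
    (hu0 : fourierSeriesL2 hw (u 0) =ᵐ[torusMeasure] ψ₀) :
    IsNLSSolution ω s T ψ₀ fun t =>
      fourierSeriesL2 hw (rotate (fun k => laplaceEigenvalue ω k * t) (u t)) := by
  set Λ := laplaceEigenvalue ω
  refine ⟨⟨fun t _ => memSobolev_fourierSeriesL2 hw hws _, fun t₀ ht₀ => ?_⟩, ?_, fun k t ht => ?_⟩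
  · have h := tendsto_iff_norm_sub_tendsto_zero.1
      (continuousWithinAt_rotate Λ (hu t₀ ht₀).continuousWithinAt)
    refine squeeze_zero (fun _ => Real.sqrt_nonneg _) (fun t => ?_) h
    rw [← map_sub]
    exact sobolevNorm_fourierSeriesL2_le hw hws _
  · have h : rotate (fun k => Λ k * 0) (u 0) = u 0 := by
      ext k
      simp
    simp only [h]
    exact hu0
  · set v := rotate (fun k => Λ k * t) (u t)
    have hF := rotate_nlsField hw Λ t (u t) k
    have hcoord : HasDerivWithinAt (fun t => u t k) (nlsField w Λ t (u t) k) (Set.Icc 0 T) t :=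
      (lp.evalCLM ℝ (fun _ : Fin 2 → ℤ => ℂ) 1 k).hasFDerivAt.comp_hasDerivWithinAt t (hu t ht)
    have hexp : HasDerivAt (fun τ : ℝ => Complex.exp (Complex.I * ((Λ k * τ : ℝ) : ℂ)))
        (Complex.exp (Complex.I * ((Λ k * t : ℝ) : ℂ)) * (Complex.I * (Λ k : ℝ))) t := by
      have := ((((hasDerivAt_id t).const_mul (Λ k)).ofReal_comp).const_mul Complex.I).cexp
      simpa using this
    have hprod := (hexp.hasDerivWithinAt.mul hcoord).mul_const (w k : ℂ)⁻¹
    simp only [mFourierCoeff_fourierSeriesL2, rotate_apply]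
    refine ⟨_, hprod, ?_⟩
    rw [mFourierCoeff_norm_sq_mul hw v (coeFn_fourierSeriesL2 hw v) k, hF,
      show v k = Complex.exp (Complex.I * ((Λ k * t : ℝ) : ℂ)) * u t k from rfl]
    linear_combination (Complex.exp (Complex.I * ((Λ k * t : ℝ) : ℂ)) * Λ k * u t k +
      cubicSum (fun x => (weightRatio w x : ℂ)) v v v k) * (w k : ℂ)⁻¹ * Complex.I_sq

/-- The spectrum is finite, so any weight is admissible. Of the H^s norm only the bound on the L²
norm is kept, since the long time argument needs smallness of the mass alone. -/
theorem exists_initial_seq {w : (Fin 2 → ℤ) → ℝ} (hw : IsSubmultWeight w) {s : ℝ} (hs : 0 ≤ s)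
    (Q : Finset (Fin 2 → ℤ)) {ψ₀ : Torus2 → ℂ} (hψ₀ : Continuous ψ₀)
    (hQ : ∀ k ∉ Q, mFourierCoeff ψ₀ k = 0) :
    ∃ a : SummableSeq (Fin 2 → ℤ), removeFreq Q a = 0 ∧
      fourierSeriesL2 hw a =ᵐ[torusMeasure] ψ₀ ∧ ‖fourierSeriesL2 hw a‖ ≤ sobolevNorm s ψ₀ := by
  set a : SummableSeq (Fin 2 → ℤ) := mk (fun k => mFourierCoeff ψ₀ k * (w k : ℂ))
    (summable_of_ne_finset_zero (s := Q) fun k hk => by simp [hQ k hk])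
  have hcoef : ∀ k, mFourierCoeff (fourierSeriesL2 hw a) k = mFourierCoeff ψ₀ k := fun k => by
    have hne := Complex.ofReal_ne_zero.2 (hw.pos k).ne'
    rw [mFourierCoeff_fourierSeriesL2, mk_apply, mul_assoc, mul_inv_cancel₀ hne, mul_one]
  set f : C(Torus2, ℂ) := ⟨ψ₀, hψ₀⟩
  have hf : (ContinuousMap.toLp 2 torusMeasure ℂ f : L2Torus) =ᵐ[torusMeasure] ψ₀ :=
    ContinuousMap.coeFn_toLp torusMeasure f
  have heq : fourierSeriesL2 hw a = ContinuousMap.toLp 2 torusMeasure ℂ f :=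
    ext_mFourierCoeff fun k => by rw [hcoef, mFourierCoeff_congr hf]
  refine ⟨a, ?_, heq ▸ hf, ?_⟩
  · ext k
    rw [removeFreq_apply]
    split_ifs with hk
    · rfl
    · simp [a, hQ k hk]
  · have h := hasSum_norm_sq_mFourierCoeff (fourierSeriesL2 hw a)
    simp only [hcoef] at h
    refine Real.le_sqrt_of_sq_le ?_
    rw [← h.tsum_eq]
    refine Summable.tsum_le_tsum (fun k => ?_) h.summable
      (summable_of_ne_finset_zero (s := Q) fun k hk => by simp [hQ k hk])
    exact le_mul_of_one_le_left (sq_nonneg _) (one_le_sobolevWeight hs k)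

end Existence

/-! ### Absence of outgoing resonances -/

theorem finite_boxQ (M : ℝ) : (boxQ M).Finite := by
  refine (Set.finite_Icc (fun _ : Fin 2 => -⌊M⌋) fun _ => ⌊M⌋).subset fun k hk => ?_
  refine ⟨fun i => ?_, fun i => ?_⟩
  · have := Int.le_floor.2 (show ((-k i : ℤ) : ℝ) ≤ M by
      push_cast
      exact (neg_le_abs _).trans (hk i))
    linarith
  · exact Int.le_floor.2 ((le_abs_self _).trans (hk i))

/-- A resonance is an axis-parallel rectangle, and boxes are closed under completing these. -/
theorem phase_laplaceEigenvalue_ne_zero {ω : Fin 2 → ℝ} (hω : IrrationalVector ω) {M : ℝ}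
    {x : (Fin 2 → ℤ) × (Fin 2 → ℤ) × (Fin 2 → ℤ)} (h1 : x.1 ∈ boxQ M) (h3 : x.2.2 ∈ boxQ M)
    (hout : outFreq x ∉ boxQ M) : phase (laplaceEigenvalue ω) x ≠ 0 := by
  intro h0
  refine hout fun i => ?_
  set m : Fin 2 → ℤ := fun i => x.1 i ^ 2 - x.2.1 i ^ 2 + x.2.2 i ^ 2 - outFreq x i ^ 2 with hm
  have hphase : phase (laplaceEigenvalue ω) x = 4 * Real.pi ^ 2 * ∑ i, ω i * (m i : ℝ) := by
    simp only [phase, laplaceEigenvalue, hm, Fin.sum_univ_two]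
    push_cast
    ring
  have hm0 : m = 0 := by
    by_contra hne
    rw [hphase] at h0
    exact mul_ne_zero (by positivity) (hω m hne) h0
  -- For d = a - b + c one has a² - b² + c² - d² = 2(a - b)(b - c), so in each coordinate the output
  -- equals one of the inputs a, c.
  have hi : (x.1 i - x.2.1 i) * (x.2.1 i - x.2.2 i) = 0 := by
    have h := congrFun hm0 i
    simp only [hm, outFreq, Pi.add_apply, Pi.sub_apply, Pi.zero_apply] at h
    nlinarith
  rcases mul_eq_zero.1 hi with h | h
  · have e : outFreq x i = x.2.2 i := by
      simp only [outFreq, Pi.add_apply, Pi.sub_apply]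
      omega
    rw [e]
    exact h3 i
  · have e : outFreq x i = x.1 i := by
      simp only [outFreq, Pi.add_apply, Pi.sub_apply]
      omega
    rw [e]
    exact h1 i

theorem exists_smallness_threshold (C : ℝ) {γ : ℝ} (hγ : γ < 3) :
    ∃ ε₀ : ℝ, 0 < ε₀ ∧ ∀ ε : ℝ, 0 < ε → ε < ε₀ → C * ε ^ 2 < 1 ∧ C * ε ^ 3 < ε ^ γ := by
  have h1 : Tendsto (fun ε : ℝ => C * ε ^ 2) (𝓝[>] 0) (𝓝 0) := by
    have : Continuous fun ε : ℝ => C * ε ^ 2 := by fun_prop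
    simpa using (this.tendsto 0).mono_left nhdsWithin_le_nhds
  have h2 : Tendsto (fun ε : ℝ => C * ε ^ (3 - γ)) (𝓝[>] 0) (𝓝 0) := by
    have := ((Real.continuousAt_rpow_const 0 (3 - γ) (Or.inr (by linarith))).tendsto).const_mul C
    rw [Real.zero_rpow (by linarith), mul_zero] at this
    exact this.mono_left nhdsWithin_le_nhds
  obtain ⟨ε₀, hε₀, h⟩ := mem_nhdsGT_iff_exists_Ioo_subset.1
    ((h1.eventually_lt_const zero_lt_one).and (h2.eventually_lt_const zero_lt_one))
  refine ⟨ε₀, hε₀, fun ε hε hlt => ⟨(h ⟨hε, hlt⟩).1, ?_⟩⟩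
  have h3 : C * ε ^ (3 - γ) < 1 := (h ⟨hε, hlt⟩).2
  have h4 : ε ^ (3 : ℕ) = ε ^ (3 - γ) * ε ^ γ := by
    rw [← Real.rpow_add hε, sub_add_cancel, ← Real.rpow_natCast]
    norm_num
  rw [h4, ← mul_assoc]
  exact mul_lt_of_lt_one_left (Real.rpow_pos_of_pos hε γ) h3

end

/-! ### Assembly of the main theorem -/

theorem theorem1p1 (s γ M : ℝ) (hs : 1 < s) (hγ : γ < 3) (hM : 0 < M)
    (ω : Fin 2 → ℝ) (hωpos : ∀ i, 0 < ω i) (hω : IrrationalVector ω) :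
    ∃ ε₀ : ℝ, 0 < ε₀ ∧
      ∀ (ψ₀ : Torus2 → ℂ) (ε : ℝ),
        SmoothOnTorus ψ₀ →
        sobolevNorm s ψ₀ = ε → 0 < ε → ε < ε₀ →
        (∀ k : Fin 2 → ℤ, k ∉ boxQ M → UnitAddTorus.mFourierCoeff ψ₀ k = 0) →
        ∃ ψ : ℝ → L2Torus,
          IsNLSSolution ω s (1 / ε ^ 2) ψ₀ ψ ∧
          (∀ φ : ℝ → L2Torus, IsNLSSolution ω s (1 / ε ^ 2) ψ₀ φ →
            ∀ t ∈ Set.Icc 0 (1 / ε ^ 2), φ t = ψ t) ∧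
          ∀ t ∈ Set.Icc 0 (1 / ε ^ 2), ∀ j : Fin 2 → ℤ, j ∉ boxQ M →
            ‖UnitAddTorus.mFourierCoeff (ψ t) j‖ < ε ^ γ := by
  -- The weight must dominate the H^s weight, so that a solution in weighted ℓ¹ is a continuous
  -- curve in H^s.
  have hw := isSubmultWeight_productWeight ⌈s⌉₊
  have hws := sobolevWeight_le (Nat.le_ceil s)
  set Q := (finite_boxQ M).toFinset
  have hmemQ : ∀ k, k ∈ Q ↔ k ∈ boxQ M := fun k => (finite_boxQ M).mem_toFinset
  have hres : ∀ x ∈ outgoing Q, phase (laplaceEigenvalue ω) x ≠ 0 := fun x hx => by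
    simp only [outgoing, Finset.mem_filter, Finset.mem_product, hmemQ] at hx
    exact phase_laplaceEigenvalue_ne_zero hω hx.1.1 hx.1.2.2 hx.2
  obtain ⟨C, -, hC⟩ := exists_long_time_solution hw (laplaceEigenvalue ω) Q hres
  obtain ⟨ε₀, hε₀, hsmall⟩ := exists_smallness_threshold C hγ
  refine ⟨ε₀, hε₀, fun ψ₀ ε hsmooth hnorm hε hlt hsupp => ?_⟩
  obtain ⟨h1, h2⟩ := hsmall ε hε hlt
  obtain ⟨a₀, ha₀, hinit, hmass⟩ := exists_initial_seq hw (zero_le_one.trans hs.le) Q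
    hsmooth.continuous fun k hk => hsupp k fun h => hk ((hmemQ k).2 h)
  obtain ⟨u, hu0, hu, hout⟩ := hC ε hε h1 a₀ ha₀ (hmass.trans_eq hnorm)
  have hsol := isNLSSolution_fourierSeriesL2 (ψ₀ := ψ₀) hw hws hu (by rwa [hu0])
  refine ⟨_, hsol, fun φ hφ t ht => hφ.unique hs hsol ht, fun t ht j hj => ?_⟩
  refine lt_of_le_of_lt ?_ ((hout t ht).trans_lt h2)
  have h3 := SummableSeq.norm_apply_le (removeFreq Q (u t)) j
  rw [removeFreq_apply, if_neg fun h => hj ((hmemQ j).1 h)] at h3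
  rw [mFourierCoeff_fourierSeriesL2, SummableSeq.rotate_apply, norm_mul, norm_mul,
    SummableSeq.norm_exp_I_mul, one_mul, norm_inv, Complex.norm_real,
    Real.norm_of_nonneg (hw.pos j).le]
  exact (mul_le_of_le_one_right (norm_nonneg _) (inv_le_one_of_one_le₀ (hw.one_le j))).trans h3
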